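/- Let $K$ be a field, let $n\ge 0$ be an integer, and let $p,q\in K$ be nonzero elements with fixed square roots $p^{1/2},q^{1/2}\in K$ (for example, $p^{1/2}$ and $q^{1/2}$ independent variables over $\mathbb{Q}$ and $K=\mathbb{Q}(p^{1/2},q^{1/2})$). For a monomial $y=q^ap^b$ with $a,b\in\mathbb{Z}$ let $y^{1/2}=(q^{1/2})^a(p^{1/2})^b$ and $y^{-1/2}=1/y^{1/2}$, and put $$\gamma(y)=y^{1/2}-y^{-1/2},\qquad \tau(y)=y^{1/2}+y^{-1/2}.$$ Define $n\times n$ matrices, with indices $1\le i,j\le n$, by \begin{align*} T_1(p,q)_{i,j}&=\frac{\gamma(q^{n+j-i})}{\gamma(p^{n+j-i})}, & T_2(p,q)_{i,j}&=\frac{\tau(q^{j-i})}{\tau(p^{j-i})},\\ T_3(p,q)_{i,j}&=\frac{\gamma(q^{n+j+i})}{\gamma(p^{n+j+i})}-\frac{\gamma(q^{n+j-i})}{\gamma(p^{n+j-i})}, & T_4(p,q)_{i,j}&=\frac{\tau(q^{j+i})}{\tau(p^{j+i})}-\frac{\tau(q^{j-i})}{\tau(p^{j-i})}. \end{align*} Then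 each of the following four identities holds whenever all denominators in the entries of the matrix concerned are nonzero in $K$. Indices in the products are positive integers; where no upper bound is written they run over $1,\dots,n$, and products indexed by $i\ne j$ or by $i,j$ run over ordered pairs. \begin{align*} \det T_1 &= \frac{\prod_{i \ne j} \gamma(p^{j-i})\prod_{i,j} \gamma(qp^{j-i})}{\prod_{i,j} \gamma(p^{n+j-i})},\\ \det T_2 &= (-1)^{\binom{n}{2}}\,\frac{2^n\prod_{i \ne j,\ 2\mid j-i}\gamma(p^{j-i})\prod_{i,j,\ 2\nmid j-i}\gamma(qp^{j-i})}{\prod_{i,j} \tau(p^{j-i})},\\ \det T_3 &= \frac{\prod_{i<j\le 2n}\gamma(p^{j-i})\prod_{i,j \le 2n+1,\ 2\mid j}\gamma(qp^{j-i})}{\prod_{i,j} \gamma(p^{n+j-i})\gamma(p^{n+j+i})},\\ \det T_4 &= (-1)^{\binom{n}{2}}\,\frac{2^n\prod_{i<j \le n} \gamma(p^{2(j-i)})^2\prod_{i,j \le 2n+1,\ 2\nmid i,\ 2\mid j} \gamma(qp^{j-i})}{\prod_{i,j} \tau(p^{j-i})\tau(p^{j+i})}. \end{align*} -/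

import Mathlib

open Finset

section RoundDeterminants

variable {K : Type*} [Field K]

/-- `γ(y) = y^{1/2} - y^{-1/2}`, as a function of the chosen square root `r = y^{1/2}`. -/
def gammaOfSqrt (r : K) : K := r - r⁻¹

/-- `τ(y) = y^{1/2} + y^{-1/2}`, as a function of the chosen square root `r = y^{1/2}`. -/
def tauOfSqrt (r : K) : K := r + r⁻¹

/-- `γ(q^a p^b)`, where `s = p^{1/2}` and `t = q^{1/2}`, so that `(q^a p^b)^{1/2} = t^a s^b`. -/
def γpq (s t : K) (a b : ℤ) : K := gammaOfSqrt (t ^ a * s ^ b)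

/-- `τ(q^a p^b)`, where `s = p^{1/2}` and `t = q^{1/2}`, so that `(q^a p^b)^{1/2} = t^a s^b`. -/
def τpq (s t : K) (a b : ℤ) : K := tauOfSqrt (t ^ a * s ^ b)

/-- The row or column label in `{1, …, n}` of an element of `Fin n`. -/
def label {n : ℕ} (i : Fin n) : ℤ := (i : ℤ) + 1

/-- `T₁(p,q)_{i,j} = γ(q^{n+j-i}) / γ(p^{n+j-i})`, `1 ≤ i, j ≤ n`. -/
def T₁ (n : ℕ) (s t : K) : Matrix (Fin n) (Fin n) K :=
  Matrix.of fun i j =>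
    γpq s t (n + label j - label i) 0 / γpq s t 0 (n + label j - label i)

/-- `T₂(p,q)_{i,j} = τ(q^{j-i}) / τ(p^{j-i})`, `1 ≤ i, j ≤ n`. -/
def T₂ (n : ℕ) (s t : K) : Matrix (Fin n) (Fin n) K :=
  Matrix.of fun i j =>
    τpq s t (label j - label i) 0 / τpq s t 0 (label j - label i)

/-- `T₃(p,q)_{i,j} = γ(q^{n+j+i}) / γ(p^{n+j+i}) - γ(q^{n+j-i}) / γ(p^{n+j-i})`,
`1 ≤ i, j ≤ n`. -/
def T₃ (n : ℕ) (s t : K) : Matrix (Fin n) (Fin n) K :=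
  Matrix.of fun i j =>
    γpq s t (n + label j + label i) 0 / γpq s t 0 (n + label j + label i)
      - γpq s t (n + label j - label i) 0 / γpq s t 0 (n + label j - label i)

/-- `T₄(p,q)_{i,j} = τ(q^{j+i}) / τ(p^{j+i}) - τ(q^{j-i}) / τ(p^{j-i})`, `1 ≤ i, j ≤ n`. -/
def T₄ (n : ℕ) (s t : K) : Matrix (Fin n) (Fin n) K :=
  Matrix.of fun i j =>
    τpq s t (label j + label i) 0 / τpq s t 0 (label j + label i)
      - τpq s t (label j - label i) 0 / τpq s t 0 (label j - label i)

end RoundDeterminants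

/-!
The matrices are studied as functions of `q`, with `p` fixed and generic. After scaling rows and
columns by powers of `q^{1/2}`, each determinant becomes a polynomial in `q`, and it is determined
by its degree, its zeros and one value.

*Zeros.* At `q = p^k` an entry `γ(q^m) / γ(p^m)` or `τ(q^m) / τ(p^m)` (the latter for odd `k`) is a
sum of `|k|` exponentials in `m` (`exists_kappa_quot_eq_sum`), so `T₁` and `T₂` have rank at most
`|k|` there. In the differences occurring in `T₃` and `T₄` opposite exponentials pair up, and the
rank is at most `⌊|k| / 2⌋` (`exists_kappa_quot_sub_eq_sum`). A polynomial matrix of size `n` whose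
value at a point has rank at most `r` has a determinant vanishing there to order at least `n - r`
(`X_sub_C_pow_dvd_det`). These orders are the multiplicities of `p^k` as a zero of the product of
the `γ(q p^{j-i})` in the formula, and they add up to the bound on the degree. Hence the determinant
is a constant multiple of that product (`eval_mul_prod_eq_of_pow_dvd`, `det_mul_prod_eq_of_rank`).

*Constant.* For `T₁`, `T₃`, `T₄` the constant is read off at `q = 0`, after scaling, and for `T₂` at
`q = 1`. In each case the matrix degenerates to a Cauchy matrix (`det_cauchy_kappa`).

*Arbitrary `p`.* The argument needs the powers of `p` to be distinct. After multiplication by the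
denominators, both sides of each identity are Laurent polynomials in `p^{1/2}`; they agree over the
field of rational functions in `p^{1/2}`, hence after every specialisation
(`det_div_specialize_laurent`).
-/

/-! ### Determinants over commutative rings -/

/-- A matrix congruent modulo `c` to one that factors through rank `r` has determinant divisible by
`c ^ (n - r)`. Its determinant is that of the block matrix `[1, V; -U, c N]`; scaling the first `r`
columns by `c` makes the last `n` rows divisible by `c`. -/
theorem pow_sub_dvd_det_mul_add_smul {R : Type*} [CommRing R] [IsDomain R] {n r : ℕ} (c : R)
    (hc : c ≠ 0) (U : Matrix (Fin n) (Fin r) R) (V : Matrix (Fin r) (Fin n) R)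
    (N : Matrix (Fin n) (Fin n) R) :
    c ^ (n - r) ∣ (U * V + c • N).det := by
  rcases le_total n r with h | h
  · simp [Nat.sub_eq_zero_of_le h]
  have h1 : (U * V + c • N).det = (Matrix.fromBlocks 1 V (-U) (c • N)).det := by
    rw [Matrix.det_fromBlocks_one₁₁]
    congr 1
    rw [Matrix.neg_mul, sub_neg_eq_add, add_comm]
  have h2 : Matrix.fromBlocks (1 : Matrix (Fin r) (Fin r) R) V (-U) (c • N) *
      Matrix.fromBlocks (c • 1) 0 0 1 =
      Matrix.fromBlocks 1 0 0 (c • 1) * Matrix.fromBlocks (c • 1) V (-U) N := by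
    simp [Matrix.fromBlocks_multiply]
  have h3 := congrArg Matrix.det h2
  rw [Matrix.det_mul, Matrix.det_mul, ← h1, Matrix.det_fromBlocks_zero₂₁,
    Matrix.det_fromBlocks_zero₂₁] at h3
  simp only [Matrix.det_smul, Matrix.det_one, mul_one, Fintype.card_fin, one_mul] at h3
  refine ⟨(Matrix.fromBlocks (c • 1) V (-U) N).det, ?_⟩
  have h4 : c ^ n = c ^ r * c ^ (n - r) := by rw [← pow_add, Nat.add_sub_cancel' h]
  rw [h4] at h3
  exact mul_right_cancel₀ (pow_ne_zero r hc) (by rw [h3]; ring)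

/-- If the value of a polynomial matrix at `a` is a sum of `r` matrices of rank one, its determinant
vanishes at `a` to order at least `n - r`. -/
theorem X_sub_C_pow_dvd_det {F : Type*} [Field F] {n : ℕ}
    (M : Matrix (Fin n) (Fin n) (Polynomial F)) (a : F) (r : ℕ) (u v : ℕ → Fin n → F)
    (h : ∀ i j, (M i j).eval a = ∑ l ∈ range r, u l i * v l j) :
    (Polynomial.X - Polynomial.C a) ^ (n - r) ∣ M.det := by
  have h1 : ∀ i j, ∃ q, M i j - Polynomial.C (∑ l ∈ range r, u l i * v l j) =
      (Polynomial.X - Polynomial.C a) * q := fun i j => by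
    rw [← h]
    exact Polynomial.X_sub_C_dvd_sub_C_eval
  choose N hN using h1
  have h2 : M = (Matrix.of fun i (l : Fin r) => Polynomial.C (u l i)) *
      (Matrix.of fun (l : Fin r) j => Polynomial.C (v l j)) +
      (Polynomial.X - Polynomial.C a) • (Matrix.of N) := by
    ext1 i j
    simp only [Matrix.add_apply, Matrix.mul_apply, Matrix.smul_apply, Matrix.of_apply,
      smul_eq_mul, ← hN, ← map_mul, ← map_sum]
    rw [Fin.sum_univ_eq_sum_range (fun l => u l i * v l j) r]
    ring
  rw [h2]
  exact pow_sub_dvd_det_mul_add_smul _ (Polynomial.X_sub_C_ne_zero a) _ _ _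

theorem natDegree_det_le_of_forall {R : Type*} [CommRing R] {n : ℕ}
    (M : Matrix (Fin n) (Fin n) (Polynomial R)) (a b : Fin n → ℕ)
    (h : ∀ i j, (M i j).natDegree ≤ a i + b j) :
    M.det.natDegree ≤ ∑ i, a i + ∑ j, b j := by
  rw [Matrix.det_apply]
  refine Polynomial.natDegree_sum_le_of_forall_le _ _ fun σ _ => ?_
  refine (Polynomial.natDegree_smul_le _ _).trans ?_
  refine (Polynomial.natDegree_prod_le _ _).trans ?_
  refine (Finset.sum_le_sum fun i _ => h (σ i) i).trans ?_
  rw [Finset.sum_add_distrib, Equiv.sum_comp σ a]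

theorem det_mul_mul {R : Type*} [CommRing R] {n : ℕ}
    (M : Matrix (Fin n) (Fin n) R) (a b : Fin n → R) :
    (Matrix.of fun i j => a i * b j * M i j).det = (∏ i, a i) * (∏ j, b j) * M.det := by
  have : (Matrix.of fun i j => a i * b j * M i j) =
      Matrix.of fun i j => a i * (Matrix.of fun i j => b j * M i j) i j := by
    ext; simp [mul_assoc]
  rw [this, Matrix.det_mul_column, Matrix.det_mul_row, mul_assoc]

/-- Multiplying row `i` by all its denominators removes the quotients from the determinant. -/
theorem det_div_mul_prod {F : Type*} [Field F] {n : ℕ} (N D : Fin n → Fin n → F)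
    (hD : ∀ i j, D i j ≠ 0) :
    (Matrix.of fun i j => N i j / D i j).det * ∏ i, ∏ j, D i j =
      (Matrix.of fun i j => N i j * ∏ k ∈ univ.erase j, D i k).det := by
  rw [mul_comm, ← Matrix.det_mul_column]
  congr 1
  ext i j
  simp only [Matrix.of_apply]
  rw [← Finset.mul_prod_erase univ _ (mem_univ j)]
  field_simp [hD i j]

theorem det_map_div_mul_prod {A E : Type*} [CommRing A] [Field E] (ψ : A →+* E) {n : ℕ}
    (N D : Fin n → Fin n → A) (hψ : ∀ i j, ψ (D i j) ≠ 0) :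
    (Matrix.of fun i j => ψ (N i j) / ψ (D i j)).det * ∏ i, ∏ j, ψ (D i j) =
      ψ (Matrix.of fun i j => N i j * ∏ k ∈ univ.erase j, D i k).det := by
  rw [det_div_mul_prod _ _ hψ, RingHom.map_det]
  congr 1
  ext i j
  simp [map_prod]

/-- An evaluation of `det (N / D)` that holds in a field containing the ring `A` persists under
every homomorphism from `A` to a field that does not kill the denominators `D`: multiplied by the
denominators, it is an identity in `A`. -/
theorem det_div_specialize {A F K : Type*} [CommRing A] [Field F] [Field K] (ι : A →+* F)
    (hι : Function.Injective ι) (φ : A →+* K) {n : ℕ} (N D : Fin n → Fin n → A) (P : A)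
    (hD : ∀ i j, φ (D i j) ≠ 0)
    (h : (Matrix.of fun i j => ι (N i j) / ι (D i j)).det * ∏ i, ∏ j, ι (D i j) = ι P) :
    (Matrix.of fun i j => φ (N i j) / φ (D i j)).det * ∏ i, ∏ j, φ (D i j) = φ P := by
  rw [det_map_div_mul_prod φ N D hD]
  rw [det_map_div_mul_prod ι N D fun i j h0 => hD i j (by
    rw [(map_eq_zero_iff ι hι).1 h0, map_zero])] at h
  rw [hι h]

/-! ### The Cauchy determinant -/

theorem prod_prod_ne_eq {M : Type*} [CommMonoid M] {n : ℕ} (f : Fin n → Fin n → M) :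
    ∏ i, ∏ j ∈ univ.erase i, f i j = ∏ i, ∏ j ∈ Ioi i, f i j * f j i := by
  rw [Finset.prod_prod_Ioi_mul_eq_prod_prod_off_diag (fun j i => f i j)]
  simp [Finset.compl_eq_univ_sdiff, Finset.sdiff_singleton_eq_erase]

/-- Cauchy's determinant. The polynomials `∏_{k ≠ j} (X + y k)` have degree `< n`, so their
values at the `x i` are a Vandermonde matrix times a matrix independent of `x`; the choice
`x = -y` identifies the determinant of the latter. -/
theorem det_cauchy {F : Type*} [Field F] {n : ℕ} (x y : Fin n → F)
    (hy : Function.Injective y) (hxy : ∀ i j, x i + y j ≠ 0) :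
    (Matrix.of fun i j => 1 / (x i + y j)).det * ∏ i, ∏ j, (x i + y j) =
      ∏ i, ∏ j ∈ Ioi i, (x j - x i) * (y j - y i) := by
  rw [det_div_mul_prod _ _ hxy]
  set p : Fin n → Polynomial F := fun j =>
    ∏ k ∈ univ.erase j, (Polynomial.X + Polynomial.C (y k)) with hp
  set A : Matrix (Fin n) (Fin n) F := Matrix.of fun l j => (p j).coeff l with hA
  have hdeg : ∀ j, (p j).natDegree < n := fun j => by
    have hn : 0 < n := Fin.pos j
    have : (p j).natDegree = n - 1 := by
      rw [hp, Polynomial.natDegree_prod _ _ fun k _ => Polynomial.X_add_C_ne_zero _]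
      simp
    omega
  have hW : ∀ z : Fin n → F, (Matrix.of fun i j => (p j).eval (z i)) =
      Matrix.vandermonde z * A := fun z => by
    ext i j
    simp only [Matrix.of_apply, Matrix.mul_apply, Matrix.vandermonde_apply, hA]
    rw [Polynomial.eval_eq_sum_range' (hdeg j),
      ← Fin.sum_univ_eq_sum_range (fun l => (p j).coeff l * z i ^ l)]
    exact Finset.sum_congr rfl fun _ _ => mul_comm _ _
  have hx : (Matrix.of fun i j => 1 * ∏ k ∈ univ.erase j, (x i + y k)).det =
      (Matrix.vandermonde x).det * A.det := by
    rw [← Matrix.det_mul, ← hW]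
    simp [hp, Polynomial.eval_prod]
  have hdiag : (Matrix.of fun i j => (p j).eval (-y i)) =
      Matrix.diagonal fun j => ∏ k ∈ univ.erase j, (y k - y j) := by
    ext i j
    by_cases h : i = j
    · subst h
      simp [hp, Polynomial.eval_prod, sub_eq_neg_add]
    · rw [Matrix.diagonal_apply_ne _ h, Matrix.of_apply, hp, Polynomial.eval_prod]
      exact Finset.prod_eq_zero (mem_erase.2 ⟨h, mem_univ i⟩) (by simp)
  have hy' : ∏ i, ∏ j ∈ Ioi i, (y j - y i) * (y i - y j) =
      (Matrix.vandermonde fun i => -y i).det * A.det := by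
    rw [← Matrix.det_mul, ← hW, hdiag, Matrix.det_diagonal,
      prod_prod_ne_eq (fun j k => y k - y j)]
  rw [hx]
  have hV : (Matrix.vandermonde fun i => -y i).det ≠ 0 :=
    Matrix.det_vandermonde_ne_zero_iff.2 (neg_injective.comp hy)
  have hA' : A.det = ∏ i, ∏ j ∈ Ioi i, (y j - y i) := by
    apply mul_left_cancel₀ hV
    rw [← hy', Matrix.det_vandermonde]
    simp only [Finset.prod_mul_distrib]
    rw [mul_comm]
    congr 1
    exact Finset.prod_congr rfl fun i _ => Finset.prod_congr rfl fun j _ => by ring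
  rw [hA', Matrix.det_vandermonde]
  simp only [Finset.prod_mul_distrib]

/-! ### The functions `r - σ r⁻¹` and their quotients -/

/-- `r - σ r⁻¹`: the function `γ` for `σ = 1` and `τ` for `σ = -1`, in terms of the square root
`r` of the argument. -/
def kappa {F : Type*} [Field F] (σ r : F) : F := r - σ * r⁻¹

theorem kappa_inv {F : Type*} [Field F] {σ : F} (hσ : σ * σ = 1) (r : F) :
    kappa σ r⁻¹ = -σ * kappa σ r := by
  simp only [kappa, inv_inv]
  linear_combination (-r⁻¹) * hσ

theorem prod_Ioi_const {F : Type*} [Field F] (n : ℕ) (σ : F) :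
    ∏ i : Fin n, ∏ _j ∈ Ioi i, σ = σ ^ n.choose 2 := by
  simp only [prod_const, Fin.card_Ioi]
  rw [Finset.prod_pow_eq_pow_sum, Fin.sum_univ_eq_sum_range (fun i => n - 1 - i),
    Finset.sum_range_reflect (fun i => i), Finset.sum_range_id, Nat.choose_two_right]

/-- Cauchy's determinant in multiplicatively symmetric form. -/
theorem det_cauchy_kappa {F : Type*} [Field F] {n : ℕ} (σ : F)
    (u v : Fin n → F) (hu : ∀ i, u i ≠ 0) (hv : ∀ i, v i ≠ 0)
    (hv2 : Function.Injective fun j => v j ^ 2) (h : ∀ i j, kappa σ (v j / u i) ≠ 0) :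
    (Matrix.of fun i j => 1 / kappa σ (v j / u i)).det * ∏ i, ∏ j, kappa σ (v j / u i) =
      σ ^ n.choose 2 *
        ∏ i, ∏ j ∈ Ioi i, kappa 1 (u i / u j) * kappa 1 (v j / v i) := by
  have hk : ∀ i j, -σ * u i ^ 2 + v j ^ 2 = u i * v j * kappa σ (v j / u i) := fun i j => by
    have := hu i; have := hv j
    simp only [kappa]; field_simp; ring
  have hne : ∀ i j, -σ * u i ^ 2 + v j ^ 2 ≠ 0 := fun i j => by
    rw [hk]; exact mul_ne_zero (mul_ne_zero (hu i) (hv j)) (h i j)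
  have hc := det_cauchy (fun i => -σ * u i ^ 2) (fun j => v j ^ 2) hv2 hne
  have h1 : (Matrix.of fun i j => 1 / kappa σ (v j / u i)) =
      Matrix.of fun i j => u i * v j *
        (Matrix.of fun i j => 1 / (-σ * u i ^ 2 + v j ^ 2)) i j := by
    ext i j
    simp only [Matrix.of_apply]
    rw [hk]
    have := hu i; have := hv j; have := h i j
    field_simp
  have h2 : ∏ i, ∏ j, (-σ * u i ^ 2 + v j ^ 2) =
      (∏ i, ∏ j, u i * v j) * ∏ i, ∏ j, kappa σ (v j / u i) := by
    simp only [hk, prod_mul_distrib]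
  have h3 : ∏ i, ∏ j ∈ Ioi i, (-σ * u j ^ 2 - -σ * u i ^ 2) * (v j ^ 2 - v i ^ 2) =
      (∏ i, ∏ j ∈ Ioi i, (u i * v i) * (u j * v j)) * (σ ^ n.choose 2 *
        ∏ i, ∏ j ∈ Ioi i, kappa 1 (u i / u j) * kappa 1 (v j / v i)) := by
    rw [← prod_Ioi_const]
    simp only [← prod_mul_distrib]
    refine prod_congr rfl fun i _ => prod_congr rfl fun j _ => ?_
    have := hu i; have := hv j; have := hu j; have := hv i
    simp only [kappa]
    field_simp
    ring
  have h4 : (∏ i, u i) * (∏ j, v j) * ∏ i, ∏ j ∈ Ioi i, (u i * v i) * (u j * v j) =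
      ∏ i, ∏ j, u i * v j := by
    rw [← prod_prod_ne_eq (fun i _ => u i * v i), ← prod_mul_distrib, ← prod_mul_distrib]
    have : ∀ i, u i * v i * ∏ _j ∈ univ.erase i, u i * v i = u i ^ n * v i ^ n := fun i => by
      rw [mul_prod_erase univ (fun _ => u i * v i) (mem_univ i)]
      simp [mul_pow]
    rw [prod_congr rfl fun i _ => this i]
    simp only [prod_mul_distrib, prod_const, card_univ, Fintype.card_fin, prod_pow]
  rw [h2, h3] at hc
  rw [h1, det_mul_mul]
  have h5 : ∏ i, ∏ j, u i * v j ≠ 0 :=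
    prod_ne_zero_iff.2 fun i _ => prod_ne_zero_iff.2 fun j _ => mul_ne_zero (hu i) (hv j)
  apply mul_left_cancel₀ h5
  rw [← h4] at hc ⊢
  linear_combination ((∏ i, u i) * (∏ j, v j)) * hc

theorem kappa_zpow_of_nonpos {F : Type*} [Field F] {σ : F} (hσ : σ * σ = 1) {s : F} {k : ℤ}
    (h : k ≤ 0) (m : ℤ) : kappa σ ((s ^ k) ^ m) = -σ * kappa σ ((s ^ k.natAbs) ^ m) := by
  rw [← kappa_inv hσ, ← inv_zpow, ← zpow_natCast, ← zpow_neg]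
  congr 3; omega

/-- At `q = p ^ k`, the quotient `κ(q^m) / κ(p^m)` is a sum of `|k|` exponentials in `m`. -/
theorem exists_kappa_quot_eq_sum {F : Type*} [Field F] {σ s : F} (hσ : σ * σ = 1) (hs : s ≠ 0)
    (k : ℤ) (hk : σ ^ k.natAbs = σ) :
    ∃ c e : ℕ → F, (∀ l, e l ≠ 0) ∧ ∀ m : ℤ, kappa σ (s ^ m) ≠ 0 →
      kappa σ ((s ^ k) ^ m) / kappa σ (s ^ m) = ∑ l ∈ range k.natAbs, c l * e l ^ m := by
  have key : ∀ r : ℕ, σ ^ r = σ → ∃ c e : ℕ → F, (∀ l, e l ≠ 0) ∧ ∀ m : ℤ,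
      kappa σ (s ^ m) ≠ 0 → kappa σ ((s ^ r) ^ m) / kappa σ (s ^ m) =
        ∑ l ∈ range r, c l * e l ^ m := by
    intro r hr
    refine ⟨fun l => σ ^ (r - 1 - l), fun l => s ^ (2 * l + 1) * (s ^ r)⁻¹, fun l =>
      mul_ne_zero (pow_ne_zero _ hs) (inv_ne_zero (pow_ne_zero _ hs)), fun m hm => ?_⟩
    have hsm : s ^ m ≠ 0 := zpow_ne_zero m hs
    have h1 : ∀ j : ℕ, (s ^ j) ^ m = (s ^ m) ^ j := fun j => by
      rw [← zpow_natCast, ← zpow_natCast, ← zpow_mul, ← zpow_mul, mul_comm]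
    have h2 : kappa σ (s ^ m) * s ^ m = (s ^ m) ^ 2 - σ := by
      simp only [kappa]; field_simp
    have h3 := geom_sum₂_mul ((s ^ m) ^ 2) σ r
    rw [hr, ← h2] at h3
    have h4 : kappa σ ((s ^ r) ^ m) = (((s ^ m) ^ 2) ^ r - σ) * ((s ^ m) ^ r)⁻¹ := by
      rw [h1, pow_right_comm]; simp only [kappa]; field_simp
    rw [div_eq_iff hm, h4, ← h3, sum_mul, sum_mul, sum_mul]
    refine sum_congr rfl fun l _ => ?_
    rw [mul_zpow, inv_zpow, h1, h1]
    ring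
  obtain ⟨c, e, he, H⟩ := key k.natAbs hk
  rcases le_total 0 k with h | h
  · refine ⟨c, e, he, fun m hm => ?_⟩
    rw [← H m hm, ← zpow_natCast, Int.natAbs_of_nonneg h]
  · refine ⟨fun l => -σ * c l, e, he, fun m hm => ?_⟩
    simp only [mul_assoc]
    rw [← mul_sum, ← H m hm, kappa_zpow_of_nonpos hσ h]
    ring

/-- At `q = p ^ k`, the difference of `κ(q^m) / κ(p^m)` at `m = b + a` and `m = b - a` is a sum of
`⌊|k| / 2⌋` products of a function of `a` and a function of `b`: in the expansion into
exponentials, opposite exponents pair up and a constant term cancels. -/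
theorem exists_kappa_quot_sub_eq_sum {F : Type*} [Field F] {σ s : F} (hσ : σ * σ = 1)
    (hs : s ≠ 0) (k : ℤ) (hk : σ ^ k.natAbs = σ) :
    ∃ c e : ℕ → F, ∀ a b : ℤ, kappa σ (s ^ (b + a)) ≠ 0 → kappa σ (s ^ (b - a)) ≠ 0 →
      kappa σ ((s ^ k) ^ (b + a)) / kappa σ (s ^ (b + a)) -
        kappa σ ((s ^ k) ^ (b - a)) / kappa σ (s ^ (b - a)) =
      ∑ l ∈ range (k.natAbs / 2), c l * (e l ^ a - (e l ^ a)⁻¹) * (e l ^ b - (e l ^ b)⁻¹) := by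
  have key : ∀ r : ℕ, σ ^ r = σ → ∃ c e : ℕ → F, ∀ a b : ℤ,
      kappa σ (s ^ (b + a)) ≠ 0 → kappa σ (s ^ (b - a)) ≠ 0 →
      kappa σ ((s ^ r) ^ (b + a)) / kappa σ (s ^ (b + a)) -
        kappa σ ((s ^ r) ^ (b - a)) / kappa σ (s ^ (b - a)) =
      ∑ l ∈ range (r / 2), c l * (e l ^ a - (e l ^ a)⁻¹) * (e l ^ b - (e l ^ b)⁻¹) := by
    intro r
    induction r using Nat.twoStepInduction with
    | zero =>
      intro h
      rw [pow_zero] at h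
      exact ⟨0, 1, fun a b _ _ => by simp [kappa, ← h]⟩
    | one =>
      intro h
      exact ⟨0, 1, fun a b h1 h2 => by simp [div_self h1, div_self h2]⟩
    | more r ih _ =>
      intro h
      obtain ⟨c, e, H⟩ := ih (by rw [pow_add, pow_two, hσ, mul_one] at h; exact h)
      have hrec : ∀ m : ℤ, kappa σ (s ^ m) ≠ 0 →
          kappa σ ((s ^ (r + 2)) ^ m) / kappa σ (s ^ m) =
          σ * (kappa σ ((s ^ r) ^ m) / kappa σ (s ^ m)) +
            ((s ^ (r + 1)) ^ m + ((s ^ (r + 1)) ^ m)⁻¹) := fun m hm => by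
        have e1 : ∀ j : ℕ, (s ^ j) ^ m = (s ^ m) ^ j := fun j => by
          rw [← zpow_natCast, ← zpow_natCast, ← zpow_mul, ← zpow_mul, mul_comm]
        have hsm : s ^ m ≠ 0 := zpow_ne_zero m hs
        rw [div_eq_iff hm, add_mul, mul_assoc, div_mul_cancel₀ _ hm, e1, e1, e1]
        simp only [kappa]
        rw [pow_add _ r 2, pow_add _ r 1]
        field_simp
        linear_combination ((s ^ m) ^ 2) * hσ
      refine ⟨fun l => if l < r / 2 then σ * c l else 1,
        fun l => if l < r / 2 then e l else s ^ (r + 1), fun a b h1 h2 => ?_⟩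
      · rw [hrec _ h1, hrec _ h2, show (r + 2) / 2 = r / 2 + 1 by omega, sum_range_succ]
        simp only [lt_irrefl, if_false, one_mul]
        rw [sum_congr rfl fun l hl => by rw [if_pos (mem_range.1 hl), if_pos (mem_range.1 hl)]]
        simp only [mul_assoc]
        rw [← mul_sum]
        simp only [← mul_assoc]
        rw [← H a b h1 h2]
        have hW : s ^ (r + 1) ≠ 0 := pow_ne_zero _ hs
        rw [zpow_add₀ hW, zpow_sub₀ hW]
        have := zpow_ne_zero a hW
        have := zpow_ne_zero b hW
        field_simp
        ring
  obtain ⟨c, e, H⟩ := key k.natAbs hk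
  rcases le_total 0 k with h | h
  · refine ⟨c, e, fun a b h1 h2 => ?_⟩
    rw [← H a b h1 h2, ← zpow_natCast, Int.natAbs_of_nonneg h]
  · refine ⟨fun l => -σ * c l, e, fun a b h1 h2 => ?_⟩
    simp only [mul_assoc]
    rw [← mul_sum]
    simp only [← mul_assoc]
    rw [← H a b h1 h2, kappa_zpow_of_nonpos hσ h, kappa_zpow_of_nonpos hσ h]
    ring

/-! ### Polynomials determined by the multiplicities of their zeros -/

/-- A polynomial of degree at most `#S` whose zeros are, with multiplicity, those of
`∏ z ∈ S, (p^{d z / 2} X - p^{-d z / 2})` is a multiple of that product; the conclusion expresses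
the proportionality without mentioning the constant. -/
theorem eval_mul_prod_eq_of_pow_dvd {F ι : Type*} [Field F] {s : F} (hs0 : s ≠ 0)
    (hs : ∀ k : ℤ, k ≠ 0 → s ^ k ≠ 1) (S : Finset ι) (d : ι → ℤ) (P : Polynomial F)
    (hdeg : P.natDegree ≤ #S)
    (hdvd : ∀ k : ℤ, (Polynomial.X - Polynomial.C (s ^ (2 * -k))) ^ #{z ∈ S | d z = k} ∣ P)
    (x y : F) :
    P.eval x * ∏ z ∈ S, (s ^ d z * y - s ^ (-d z)) =
      P.eval y * ∏ z ∈ S, (s ^ d z * x - s ^ (-d z)) := by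
  classical
  set Q : Polynomial F := ∏ z ∈ S, (Polynomial.X - Polynomial.C (s ^ (2 * -d z))) with hQ
  have hQm : Q.Monic := Polynomial.monic_prod_of_monic _ _ fun z _ => Polynomial.monic_X_sub_C _
  have hQdeg : Q.natDegree = #S := by
    rw [hQ, Polynomial.natDegree_prod _ _ fun z _ => Polynomial.X_sub_C_ne_zero _]
    simp
  have hQP : Q ∣ P := by
    rw [hQ, Finset.prod_comp (fun k : ℤ => Polynomial.X - Polynomial.C (s ^ (2 * -k))) d]
    refine Finset.prod_dvd_of_coprime (fun k _ l _ hkl => ?_) fun k _ => hdvd k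
    refine IsCoprime.pow (Polynomial.isCoprime_X_sub_C_of_isUnit_sub ?_)
    refine isUnit_iff_ne_zero.2 (sub_ne_zero.2 fun h => hs (2 * -k - 2 * -l) (by omega) ?_)
    rw [zpow_sub₀ hs0, h, div_self (zpow_ne_zero _ hs0)]
  -- The degrees leave only a constant cofactor.
  obtain ⟨R, rfl⟩ := hQP
  obtain ⟨c, rfl⟩ : ∃ c, R = Polynomial.C c := by
    rcases eq_or_ne R 0 with rfl | hR
    · exact ⟨0, by simp⟩
    · rw [hQm.natDegree_mul' hR, hQdeg] at hdeg
      exact ⟨_, Polynomial.eq_C_of_natDegree_eq_zero (by omega)⟩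
  have hf : ∀ w, ∏ z ∈ S, (s ^ d z * w - s ^ (-d z)) = (∏ z ∈ S, s ^ d z) * Q.eval w := fun w => by
    rw [hQ, Polynomial.eval_prod, ← prod_mul_distrib]
    refine prod_congr rfl fun z _ => ?_
    simp only [Polynomial.eval_sub, Polynomial.eval_X, Polynomial.eval_C]
    rw [mul_sub, ← zpow_add₀ hs0]
    congr 2; ring
  rw [hf, hf, Polynomial.eval_mul, Polynomial.eval_mul, Polynomial.eval_C, Polynomial.eval_C]
  ring

/-- The determinant of the matrix `E t`, up to a factor that does not depend on `t`. Here
`t ^ (A i) * t ^ (B j) * E t i j` is a polynomial in `q = t ^ 2` of degree at most `A i + B j`, and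
at `q = p ^ k` the matrix has rank at most `n` minus the multiplicity of `p ^ k` as a zero of
`∏ z ∈ S, γ(q p^{d z})`, which is the number of `z` with `d z = -k`. -/
theorem det_mul_prod_eq_of_rank {F ι : Type*} [Field F] {s t : F} (hs0 : s ≠ 0) (ht : t ≠ 0)
    (hs : ∀ k : ℤ, k ≠ 0 → s ^ k ≠ 1) (S : Finset ι) (d : ι → ℤ) {n : ℕ}
    (E : F → Matrix (Fin n) (Fin n) F) (M : Matrix (Fin n) (Fin n) (Polynomial F))
    (A B : Fin n → ℕ) (hcard : ∑ i, A i + ∑ j, B j = #S)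
    (hdeg : ∀ i j, (M i j).natDegree ≤ A i + B j)
    (hM : ∀ w, w ≠ 0 → ∀ i j, (M i j).eval (w ^ 2) = w ^ A i * w ^ B j * E w i j)
    (hrank : ∀ k : ℤ, #{z ∈ S | d z = -k} ≠ 0 → ∃ (r : ℕ) (u v : ℕ → Fin n → F),
      #{z ∈ S | d z = -k} ≤ n - r ∧ ∀ i j, E (s ^ k) i j = ∑ l ∈ range r, u l i * v l j)
    (y : F) :
    (E t).det * ∏ z ∈ S, (s ^ d z * y - s ^ (-d z)) =
      (Matrix.of fun i j => (M i j).eval y).det * ∏ z ∈ S, kappa 1 (t * s ^ d z) := by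
  have hdet : ∀ x, M.det.eval x = (Matrix.of fun i j => (M i j).eval x).det := fun x => by
    rw [← Polynomial.coe_evalRingHom, RingHom.map_det]
    rfl
  have hE : M.det.eval (t ^ 2) = t ^ #S * (E t).det := by
    rw [hdet, ← hcard, pow_add, ← prod_pow_eq_pow_sum, ← prod_pow_eq_pow_sum, ← det_mul_mul]
    congr 1
    ext i j
    exact hM t ht i j
  have hdvd : ∀ k : ℤ, (Polynomial.X - Polynomial.C (s ^ (2 * -k))) ^ #{z ∈ S | d z = k} ∣
      M.det := fun k => by
    rcases eq_or_ne #{z ∈ S | d z = k} 0 with h | h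
    · rw [h, pow_zero]; exact one_dvd _
    obtain ⟨r, u, v, hr, H⟩ := hrank (-k) (by rwa [neg_neg])
    rw [neg_neg] at hr
    refine (pow_dvd_pow _ hr).trans ?_
    have hw : s ^ (-k) ≠ 0 := zpow_ne_zero _ hs0
    refine X_sub_C_pow_dvd_det M _ r (fun l i => (s ^ (-k)) ^ A i * u l i)
      (fun l j => (s ^ (-k)) ^ B j * v l j) fun i j => ?_
    have h2 : s ^ (2 * -k) = (s ^ (-k)) ^ 2 := by
      rw [← zpow_natCast, ← zpow_mul, mul_comm]; rfl
    rw [h2, hM _ hw, H, mul_sum]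
    exact sum_congr rfl fun l _ => by ring
  have key := eval_mul_prod_eq_of_pow_dvd hs0 hs S d M.det
    ((natDegree_det_le_of_forall M A B hdeg).trans hcard.le) hdvd (t ^ 2) y
  have hprod : ∏ z ∈ S, (s ^ d z * t ^ 2 - s ^ (-d z)) =
      t ^ #S * ∏ z ∈ S, kappa 1 (t * s ^ d z) := by
    rw [← prod_const, ← prod_mul_distrib]
    refine prod_congr rfl fun z _ => ?_
    have := zpow_ne_zero (d z) hs0
    rw [zpow_neg]
    simp only [kappa]
    field_simp
  rw [hE, hprod, hdet] at key
  apply mul_left_cancel₀ (pow_ne_zero #S ht)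
  linear_combination key

/-! ### Index sets -/

theorem label_injective {n : ℕ} : Function.Injective (label : Fin n → ℤ) := fun i j h => by
  simp only [label] at h
  ext; omega

theorem label_lt_label_iff {n : ℕ} {i j : Fin n} : label i < label j ↔ i < j := by
  simp only [label, Fin.lt_def]
  omega

@[to_additive]
theorem prod_Icc_eq_prod_label {M : Type*} [CommMonoid M] (n : ℕ) (f : ℤ → M) :
    ∏ i ∈ Icc (1 : ℤ) n, f i = ∏ i : Fin n, f (label i) := by
  symm
  refine prod_nbij label (fun i _ => ?_) (fun i _ j _ h => label_injective h) (fun z hz => ?_)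
    fun _ _ => rfl
  · rw [mem_Icc]; simp only [label]; omega
  · rw [coe_Icc, Set.mem_Icc] at hz
    exact ⟨⟨(z - 1).toNat, by omega⟩, by simp, by simp only [label]; omega⟩

theorem prod_ne_eq_prod_label {M : Type*} [CommMonoid M] (n : ℕ) (f : ℤ → ℤ → M) :
    ∏ i ∈ Icc (1 : ℤ) n, ∏ j ∈ Icc (1 : ℤ) n with i ≠ j, f i j =
      ∏ i : Fin n, ∏ j ∈ Ioi i, f (label i) (label j) * f (label j) (label i) := by
  rw [← prod_prod_ne_eq (fun i j : Fin n => f (label i) (label j)), prod_Icc_eq_prod_label]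
  refine prod_congr rfl fun i _ => ?_
  rw [prod_filter, prod_Icc_eq_prod_label, ← prod_filter]
  refine prod_congr ?_ fun _ _ => rfl
  ext j
  simp [label_injective.eq_iff, eq_comm]

theorem prod_lt_eq_prod_label {M : Type*} [CommMonoid M] (n : ℕ) (f : ℤ → ℤ → M) :
    ∏ i ∈ Icc (1 : ℤ) n, ∏ j ∈ Icc (1 : ℤ) n with i < j, f i j =
      ∏ i : Fin n, ∏ j ∈ Ioi i, f (label i) (label j) := by
  rw [prod_Icc_eq_prod_label]
  refine prod_congr rfl fun i _ => ?_
  rw [prod_filter, prod_Icc_eq_prod_label, ← prod_filter]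
  refine prod_congr ?_ fun _ _ => rfl
  ext j
  simp [label_lt_label_iff]

/-- If `S` is symmetric under `(i, j) ↦ (N - i, N - j)`, the exponents `j - i` cancel. -/
theorem prod_zpow_neg_eq_one {F : Type*} [Field F] {s : F} (hs : s ≠ 0) (S : Finset (ℤ × ℤ))
    (N : ℤ) (hS : ∀ z ∈ S, (N - z.1, N - z.2) ∈ S) :
    ∏ z ∈ S, s ^ (-(z.2 - z.1)) = 1 := by
  have h1 : ∑ z ∈ S, -(z.2 - z.1) = ∑ z ∈ S, (z.2 - z.1) :=
    sum_nbij' (fun z => (N - z.1, N - z.2)) (fun z => (N - z.1, N - z.2)) hS hS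
      (fun z _ => by simp) (fun z _ => by simp) (fun z _ => by simp)
  rw [sum_neg_distrib] at h1
  have h2 : ∀ R : Finset (ℤ × ℤ), ∏ z ∈ R, s ^ (-(z.2 - z.1)) = s ^ (-∑ z ∈ R, (z.2 - z.1)) := by
    intro R
    induction R using Finset.induction_on with
    | empty => simp
    | insert a R ha ih => rw [prod_insert ha, sum_insert ha, ih, ← zpow_add₀ hs, neg_add]
  rw [h2, show -∑ z ∈ S, (z.2 - z.1) = 0 by omega, zpow_zero]

/-- The value at `q = 0` of `∏ (i, j) ∈ S, (p^{(j-i)/2} q - p^{-(j-i)/2})` for symmetric `S`. -/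
theorem prod_zpow_mul_zero_sub {F : Type*} [Field F] {s : F} (hs : s ≠ 0) (S : Finset (ℤ × ℤ))
    (N : ℤ) (hS : ∀ z ∈ S, (N - z.1, N - z.2) ∈ S) :
    ∏ z ∈ S, (s ^ (z.2 - z.1) * 0 - s ^ (-(z.2 - z.1))) = (-1) ^ #S := by
  simp only [mul_zero, zero_sub]
  rw [prod_neg, prod_zpow_neg_eq_one hs S N hS, mul_one]

theorem card_filter_even_Icc (n : ℕ) : #{j ∈ Icc (1 : ℤ) (2 * n + 1) | 2 ∣ j} = n := by
  have : {j ∈ Icc (1 : ℤ) (2 * n + 1) | 2 ∣ j} = (Icc (1 : ℤ) n).image (2 * ·) := by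
    ext j
    simp only [mem_filter, mem_image, mem_Icc]
    exact ⟨fun h => ⟨j / 2, by omega, by omega⟩, fun ⟨a, h, e⟩ => by omega⟩
  rw [this, card_image_of_injective _ fun a b h => by simpa using h]
  simp

theorem card_filter_odd_Icc (n : ℕ) : #{j ∈ Icc (1 : ℤ) (2 * n + 1) | ¬ 2 ∣ j} = n + 1 := by
  have h := card_filter_add_card_filter_not (s := Icc (1 : ℤ) (2 * n + 1)) (fun j => 2 ∣ j)
  rw [card_filter_even_Icc, Int.card_Icc] at h
  omega

/-- A bound for the multiplicity of `p^k` as a zero of the product of all `γ(q p^{j-i})`,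
`1 ≤ i, j ≤ n`. -/
theorem card_square_sub_eq_le (n : ℕ) (k : ℤ) :
    #{z ∈ Icc (1 : ℤ) n ×ˢ Icc (1 : ℤ) n | z.2 - z.1 = -k} ≤ n - k.natAbs := by
  have : #{z ∈ Icc (1 : ℤ) n ×ˢ Icc (1 : ℤ) n | z.2 - z.1 = -k} ≤
      #(Icc (max 1 (1 + k)) (min n (n + k))) := by
    refine card_le_card_of_injOn Prod.fst (fun z hz => ?_) fun z hz w hw h => ?_
    · simp only [coe_filter, mem_product, mem_Icc, Set.mem_ofPred_eq, coe_Icc, Set.mem_Icc] at hz ⊢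
      omega
    · simp only [coe_filter, mem_product, mem_Icc, Set.mem_ofPred_eq] at hz hw
      exact Prod.ext h (by omega)
  rw [Int.card_Icc] at this
  omega

/-- A bound for the multiplicity of `p^k` as a zero of the product of all `γ(q p^{j-i})`,
`1 ≤ i, j ≤ 2n + 1`, with `j` even. -/
theorem card_even_sub_eq_le (n : ℕ) (k : ℤ) :
    #{z ∈ Icc (1 : ℤ) (2 * n + 1) ×ˢ {j ∈ Icc (1 : ℤ) (2 * n + 1) | 2 ∣ j} | z.2 - z.1 = -k} ≤
      n - k.natAbs / 2 := by
  have : #{z ∈ Icc (1 : ℤ) (2 * n + 1) ×ˢ {j ∈ Icc (1 : ℤ) (2 * n + 1) | 2 ∣ j} |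
      z.2 - z.1 = -k} ≤ #(Icc (max 1 ((2 - k) / 2)) (min n ((2 * n + 1 - k) / 2))) := by
    refine card_le_card_of_injOn (fun z => z.2 / 2) (fun z hz => ?_) fun z hz w hw h => ?_
    · simp only [coe_filter, mem_filter, mem_product, mem_Icc, Set.mem_ofPred_eq, coe_Icc,
        Set.mem_Icc] at hz ⊢
      omega
    · simp only [coe_filter, mem_filter, mem_product, mem_Icc, Set.mem_ofPred_eq] at hz hw h
      exact Prod.ext (by omega) (by omega)
  rw [Int.card_Icc] at this
  omega

/-- The sum of the distances of the labels `1, …, n` from the middle label `⌊(n + 1) / 2⌋`; one of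
the two truncated differences is always `0`. -/
theorem sum_range_dist_middle (n : ℕ) :
    ∑ i ∈ range n, (((n + 1) / 2 - (i + 1)) + ((i + 1) - (n + 1) / 2)) = n ^ 2 / 4 := by
  induction n using Nat.twoStepInduction with
  | zero => rfl
  | one => rfl
  | more n ih _ =>
    have h1 : (n + 2) ^ 2 / 4 = n ^ 2 / 4 + (n + 1) := by
      rw [show (n + 2) ^ 2 = n ^ 2 + 4 * (n + 1) by ring]; omega
    rw [h1, ← ih, sum_range_succ, sum_range_succ', show (n + 2 + 1) / 2 = (n + 1) / 2 + 1 by omega]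
    rw [sum_congr rfl fun i _ => show
      ((n + 1) / 2 + 1 - (i + 1 + 1)) + (i + 1 + 1 - ((n + 1) / 2 + 1)) =
        ((n + 1) / 2 - (i + 1)) + ((i + 1) - (n + 1) / 2) by omega]
    omega

/-- The number of zeros, with multiplicity, in the evaluation of `T₂`; it equals the bound on the
degree, twice the sum in `sum_range_dist_middle`. -/
theorem card_square_filter_odd_sub (n : ℕ) :
    #{z ∈ Icc (1 : ℤ) n ×ˢ Icc (1 : ℤ) n | ¬ 2 ∣ z.2 - z.1} = n ^ 2 / 4 + n ^ 2 / 4 := by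
  have h0 : ∀ n : ℕ, ∑ i ∈ range n, (if i % 2 = n % 2 then 0 else 1) = (n + 1) / 2 := by
    intro n
    induction n using Nat.twoStepInduction with
    | zero => rfl
    | one => rfl
    | more n ih _ =>
      rw [sum_range_succ, sum_range_succ, if_pos (by omega), if_neg (by omega),
        show (n + 2) % 2 = n % 2 by omega, ih]
      omega
  have h1 : ∀ n : ℕ, ∑ i ∈ range n, ∑ j ∈ range n, (if i % 2 = j % 2 then 0 else 1) =
      n ^ 2 / 4 + n ^ 2 / 4 := by
    intro n
    induction n with
    | zero => rfl
    | succ n ih =>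
      rw [sum_range_succ, sum_congr rfl fun i _ => sum_range_succ _ _, sum_add_distrib, ih, h0,
        sum_range_succ, if_pos rfl, sum_congr rfl fun j _ => if_congr eq_comm rfl rfl, h0]
      rcases Nat.even_or_odd' n with ⟨c, rfl | rfl⟩
      · rw [show (2 * c) ^ 2 = 4 * (c ^ 2) by ring,
          show (2 * c + 1) ^ 2 = 4 * (c ^ 2 + c) + 1 by ring]
        omega
      · rw [show (2 * c + 1) ^ 2 = 4 * (c ^ 2 + c) + 1 by ring,
          show (2 * c + 1 + 1) ^ 2 = 4 * (c ^ 2 + 2 * c + 1) by ring]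
        omega
  rw [← h1, card_filter, sum_product, sum_Icc_eq_sum_label,
    ← Fin.sum_univ_eq_sum_range fun i => ∑ j ∈ range n, if i % 2 = j % 2 then 0 else 1]
  refine sum_congr rfl fun i _ => ?_
  rw [sum_Icc_eq_sum_label, ← Fin.sum_univ_eq_sum_range fun j => if i.1 % 2 = j % 2 then 0 else 1]
  refine sum_congr rfl fun j _ => ?_
  have hd : 2 ∣ label j - label i ↔ i.1 % 2 = j.1 % 2 := by simp only [label]; omega
  by_cases h : i.1 % 2 = j.1 % 2
  · rw [if_pos h, if_neg fun h' => h' (hd.2 h)]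
  · rw [if_neg h, if_pos fun h' => h (hd.1 h')]

/-! ### The four evaluations for generic `p` -/

theorem γpq_eq_kappa {K : Type*} [Field K] (s t : K) (a b : ℤ) :
    γpq s t a b = kappa 1 (t ^ a * s ^ b) := by
  simp [γpq, gammaOfSqrt, kappa]

theorem τpq_eq_kappa {K : Type*} [Field K] (s t : K) (a b : ℤ) :
    τpq s t a b = kappa (-1) (t ^ a * s ^ b) := by
  simp [τpq, tauOfSqrt, kappa]

theorem kappa_one_zpow_ne_zero {F : Type*} [Field F] {s : F} (hs0 : s ≠ 0)
    (hs : ∀ k : ℤ, k ≠ 0 → s ^ k ≠ 1) {m : ℤ} (hm : m ≠ 0) : kappa 1 (s ^ m) ≠ 0 := by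
  intro h
  apply hs (m + m) (by omega)
  rw [zpow_add₀ hs0]
  simp only [kappa, one_mul, sub_eq_zero] at h
  nth_rewrite 1 [h]
  exact inv_mul_cancel₀ (zpow_ne_zero m hs0)

theorem kappa_neg_one_zpow_ne_zero {F : Type*} [Field F] {s : F} (hs0 : s ≠ 0)
    (hs : ∀ k : ℤ, k ≠ 0 → s ^ k ≠ 1) (h2 : (2 : F) ≠ 0) (m : ℤ) : kappa (-1) (s ^ m) ≠ 0 := by
  rcases eq_or_ne m 0 with rfl | hm
  · simpa [kappa, one_add_one_eq_two] using h2
  intro h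
  apply hs (2 * (m + m)) (by omega)
  simp only [kappa, neg_mul, one_mul, sub_neg_eq_add] at h
  have h3 : s ^ (m + m) = -1 := by
    rw [zpow_add₀ hs0]
    have := zpow_ne_zero m hs0
    field_simp at h
    linear_combination h
  rw [mul_comm, zpow_mul, h3]
  norm_num

theorem zpow_label_sq_injective {F : Type*} [Field F] {s : F} (hs0 : s ≠ 0)
    (hs : ∀ k : ℤ, k ≠ 0 → s ^ k ≠ 1) (h : ℤ) (n : ℕ) :
    Function.Injective fun j : Fin n => (s ^ (h + label j)) ^ 2 := by
  intro i j hij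
  by_contra hne
  have hl : label i ≠ label j := label_injective.ne hne
  apply hs ((h + label i) * 2 - (h + label j) * 2) (by omega)
  dsimp only at hij
  rw [← zpow_natCast, ← zpow_natCast, ← zpow_mul, ← zpow_mul] at hij
  rw [zpow_sub₀ hs0]
  exact (div_eq_one_iff_eq (zpow_ne_zero _ hs0)).2 hij

theorem det_T₁_of_generic {F : Type*} [Field F] (n : ℕ) {s t : F} (hs0 : s ≠ 0) (ht : t ≠ 0)
    (hs : ∀ k : ℤ, k ≠ 0 → s ^ k ≠ 1) :
    (T₁ n s t).det * ∏ i ∈ Icc (1 : ℤ) n, ∏ j ∈ Icc (1 : ℤ) n, γpq s t 0 (n + j - i) =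
      (∏ i ∈ Icc (1 : ℤ) n, ∏ j ∈ Icc (1 : ℤ) n with i ≠ j, γpq s t 0 (j - i)) *
        ∏ i ∈ Icc (1 : ℤ) n, ∏ j ∈ Icc (1 : ℤ) n, γpq s t 1 (j - i) := by
  have hne : ∀ i j : Fin n, kappa 1 (s ^ ((n : ℤ) + label j - label i)) ≠ 0 := fun i j =>
    kappa_one_zpow_ne_zero hs0 hs (by simp only [label]; omega)
  have hm : ∀ i j : Fin n, (n : ℤ) + label j - label i = ((n - i.1 + j.1 : ℕ) : ℤ) := fun i j => by
    simp only [label]; omega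
  have key := det_mul_prod_eq_of_rank hs0 ht hs (Icc (1 : ℤ) n ×ˢ Icc (1 : ℤ) n)
    (fun z => z.2 - z.1)
    (fun w => Matrix.of fun i j : Fin n => kappa 1 (w ^ ((n : ℤ) + label j - label i)) /
      kappa 1 (s ^ ((n : ℤ) + label j - label i)))
    (Matrix.of fun i j => Polynomial.C (1 / kappa 1 (s ^ ((n : ℤ) + label j - label i))) *
      (Polynomial.X ^ (n - i.1 + j.1) - 1))
    (fun i => n - i.1) (fun j => j.1)
    (by
      rw [← sum_add_distrib, sum_congr rfl fun i _ => Nat.sub_add_cancel i.2.le]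
      simp)
    (fun i j => by
      rw [Matrix.of_apply]
      refine (Polynomial.natDegree_C_mul_le _ _).trans ?_
      refine (Polynomial.natDegree_sub_le _ _).trans ?_
      rw [Polynomial.natDegree_X_pow, Polynomial.natDegree_one]
      exact max_le le_rfl (Nat.zero_le _))
    (fun w hw i j => by
      simp only [Matrix.of_apply, Polynomial.eval_mul, Polynomial.eval_C, Polynomial.eval_sub,
        Polynomial.eval_pow, Polynomial.eval_X, Polynomial.eval_one]
      rw [← pow_add, hm i j, zpow_natCast w, pow_right_comm]
      have := pow_ne_zero (n - i.1 + j.1) hw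
      simp only [kappa]
      field_simp)
    (fun k _ => by
      obtain ⟨c, e, he, H⟩ := exists_kappa_quot_eq_sum (one_mul (1 : F)) hs0 k (one_pow _)
      refine ⟨k.natAbs, fun l i => c l * (e l ^ label i)⁻¹, fun l j => e l ^ ((n : ℤ) + label j),
        card_square_sub_eq_le n k, fun i j => ?_⟩
      rw [Matrix.of_apply, H _ (hne i j)]
      refine sum_congr rfl fun l _ => ?_
      rw [zpow_sub₀ (he l)]
      ring) 0
  rw [prod_zpow_mul_zero_sub hs0 _ (n + 1) fun z hz => by
    simp only [mem_product, mem_Icc] at hz ⊢; omega] at key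
  have hM0 : (Matrix.of fun i j : Fin n => ((Matrix.of fun i j : Fin n =>
      Polynomial.C (1 / kappa 1 (s ^ ((n : ℤ) + label j - label i))) *
      (Polynomial.X ^ (n - i.1 + j.1) - 1)) i j).eval 0).det =
      (-1) ^ n * (Matrix.of fun i j : Fin n =>
        1 / kappa 1 (s ^ ((n : ℤ) + label j) / s ^ label i)).det := by
    have := Matrix.det_smul (Matrix.of fun i j : Fin n =>
        1 / kappa 1 (s ^ ((n : ℤ) + label j) / s ^ label i)) (-1)
    rw [Fintype.card_fin] at this
    rw [← this]
    congr 1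
    ext i j
    have h0 : n - i.1 + j.1 ≠ 0 := by omega
    simp only [Matrix.of_apply, Polynomial.eval_mul, Polynomial.eval_C, Polynomial.eval_sub,
      Polynomial.eval_pow, Polynomial.eval_X, Polynomial.eval_one, Matrix.smul_apply]
    rw [zero_pow h0, zpow_sub₀ hs0]
    simp
  rw [hM0] at key
  have hc := det_cauchy_kappa (1 : F) (fun i : Fin n => s ^ label i)
    (fun j => s ^ ((n : ℤ) + label j)) (fun i => zpow_ne_zero _ hs0) (fun i => zpow_ne_zero _ hs0)
    (zpow_label_sq_injective hs0 hs _ _) (fun i j => by rw [← zpow_sub₀ hs0]; exact hne i j)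
  have hsign : (-1 : F) ^ #(Icc (1 : ℤ) n ×ˢ Icc (1 : ℤ) n) = (-1) ^ n := by
    have : #(Icc (1 : ℤ) n ×ˢ Icc (1 : ℤ) n) = n * n := by simp
    rw [this, pow_mul]
    rcases neg_one_pow_eq_or F n with h | h <;> simp [h]
  have hT : (T₁ n s t) = Matrix.of fun i j : Fin n =>
      kappa 1 (t ^ ((n : ℤ) + label j - label i)) /
      kappa 1 (s ^ ((n : ℤ) + label j - label i)) := by
    ext i j; simp [T₁, γpq_eq_kappa]
  rw [hsign, ← hT, prod_product] at key
  have hS : ∏ i : Fin n, ∏ j ∈ Ioi i, kappa 1 (s ^ label i / s ^ label j) *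
      kappa 1 (s ^ ((n : ℤ) + label j) / s ^ ((n : ℤ) + label i)) =
      ∏ i ∈ Icc (1 : ℤ) n, ∏ j ∈ Icc (1 : ℤ) n with i ≠ j, γpq s t 0 (j - i) := by
    rw [prod_ne_eq_prod_label n fun i j => γpq s t 0 (j - i)]
    refine prod_congr rfl fun i _ => prod_congr rfl fun j _ => ?_
    rw [← zpow_sub₀ hs0, ← zpow_sub₀ hs0, add_sub_add_left_eq_sub, mul_comm, γpq_eq_kappa,
      γpq_eq_kappa, zpow_zero, one_mul, one_mul]
  have hD : ∏ i ∈ Icc (1 : ℤ) n, ∏ j ∈ Icc (1 : ℤ) n, γpq s t 0 (n + j - i) =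
      ∏ i : Fin n, ∏ j : Fin n, kappa 1 (s ^ ((n : ℤ) + label j) / s ^ label i) := by
    rw [prod_Icc_eq_prod_label]
    refine prod_congr rfl fun i _ => ?_
    rw [prod_Icc_eq_prod_label]
    refine prod_congr rfl fun j _ => ?_
    rw [← zpow_sub₀ hs0, γpq_eq_kappa, zpow_zero, one_mul]
  have hR : ∏ i ∈ Icc (1 : ℤ) n, ∏ j ∈ Icc (1 : ℤ) n, γpq s t 1 (j - i) =
      ∏ i ∈ Icc (1 : ℤ) n, ∏ j ∈ Icc (1 : ℤ) n, kappa 1 (t * s ^ (j - i)) := by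
    simp only [γpq_eq_kappa, zpow_one]
  rw [hD, hR, ← hS]
  rw [one_pow, one_mul] at hc
  rw [← hc]
  apply mul_left_cancel₀ (pow_ne_zero n (neg_ne_zero.2 (one_ne_zero (α := F))))
  linear_combination (∏ i : Fin n, ∏ j : Fin n,
    kappa 1 (s ^ ((n : ℤ) + label j) / s ^ label i)) * key

theorem det_T₂_of_generic {F : Type*} [Field F] (n : ℕ) {s t : F} (hs0 : s ≠ 0) (ht : t ≠ 0)
    (hs : ∀ k : ℤ, k ≠ 0 → s ^ k ≠ 1) (h2 : (2 : F) ≠ 0) :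
    (T₂ n s t).det * ∏ i ∈ Icc (1 : ℤ) n, ∏ j ∈ Icc (1 : ℤ) n, τpq s t 0 (j - i) =
      (-1) ^ n.choose 2 *
        (2 ^ n *
          (∏ i ∈ Icc (1 : ℤ) n, ∏ j ∈ Icc (1 : ℤ) n with i ≠ j ∧ 2 ∣ j - i,
            γpq s t 0 (j - i)) *
          ∏ i ∈ Icc (1 : ℤ) n, ∏ j ∈ Icc (1 : ℤ) n with ¬ 2 ∣ j - i, γpq s t 1 (j - i)) := by
  have hne : ∀ m : ℤ, kappa (-1) (s ^ m) ≠ 0 := kappa_neg_one_zpow_ne_zero hs0 hs h2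
  set S : Finset (ℤ × ℤ) := {z ∈ Icc (1 : ℤ) n ×ˢ Icc (1 : ℤ) n | ¬ 2 ∣ z.2 - z.1} with hSdef
  -- `c` is the middle label; `|j - i| ≤ |i - c| + |j - c|` bounds the degrees.
  set c := (n + 1) / 2 with hcdef
  have key := det_mul_prod_eq_of_rank hs0 ht hs S
    (fun z => z.2 - z.1)
    (fun w => Matrix.of fun i j : Fin n => kappa (-1) (w ^ (label j - label i)) /
      kappa (-1) (s ^ (label j - label i)))
    (Matrix.of fun i j => Polynomial.C (1 / kappa (-1) (s ^ (label j - label i))) *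
      (Polynomial.X ^ ((c - (i.1 + 1)) + ((j.1 + 1) - c)) +
        Polynomial.X ^ (((i.1 + 1) - c) + (c - (j.1 + 1)))))
    (fun i => (c - (i.1 + 1)) + ((i.1 + 1) - c)) (fun j => (c - (j.1 + 1)) + ((j.1 + 1) - c))
    (by
      rw [Fin.sum_univ_eq_sum_range (fun i => (c - (i + 1)) + ((i + 1) - c)),
        sum_range_dist_middle, card_square_filter_odd_sub])
    (fun i j => by
      rw [Matrix.of_apply]
      refine (Polynomial.natDegree_C_mul_le _ _).trans ?_
      refine (Polynomial.natDegree_add_le _ _).trans ?_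
      rw [Polynomial.natDegree_X_pow, Polynomial.natDegree_X_pow]
      exact max_le (by omega) (by omega))
    (fun w hw i j => by
      simp only [Matrix.of_apply, Polynomial.eval_mul, Polynomial.eval_C, Polynomial.eval_add,
        Polynomial.eval_pow, Polynomial.eval_X]
      have h1 : (w ^ 2) ^ ((c - (i.1 + 1)) + ((j.1 + 1) - c)) =
          w ^ ((c - (i.1 + 1)) + ((i.1 + 1) - c)) * w ^ ((c - (j.1 + 1)) + ((j.1 + 1) - c)) *
          w ^ (label j - label i) := by
        rw [← pow_mul, ← zpow_natCast, ← zpow_natCast, ← zpow_natCast, ← zpow_add₀ hw,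
          ← zpow_add₀ hw]
        congr 1; simp only [label]; omega
      have h2 : (w ^ 2) ^ (((i.1 + 1) - c) + (c - (j.1 + 1))) =
          w ^ ((c - (i.1 + 1)) + ((i.1 + 1) - c)) * w ^ ((c - (j.1 + 1)) + ((j.1 + 1) - c)) *
          (w ^ (label j - label i))⁻¹ := by
        rw [← pow_mul, ← zpow_natCast, ← zpow_natCast, ← zpow_natCast, ← zpow_neg,
          ← zpow_add₀ hw, ← zpow_add₀ hw]
        congr 1; simp only [label]; omega
      rw [h1, h2]
      simp only [kappa]
      ring)
    (fun k hk => by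
      obtain ⟨z, hz⟩ := card_ne_zero.1 hk
      rw [hSdef, mem_filter, mem_filter] at hz
      have hodd : Odd k.natAbs := by
        rw [Int.natAbs_odd, ← Int.not_even_iff_odd, even_iff_two_dvd]; omega
      obtain ⟨c, e, he, H⟩ := exists_kappa_quot_eq_sum (σ := (-1 : F)) (by norm_num) hs0 k
        hodd.neg_one_pow
      refine ⟨k.natAbs, fun l i => c l * (e l ^ label i)⁻¹, fun l j => e l ^ label j,
        (card_le_card ?_).trans (card_square_sub_eq_le n k), fun i j => ?_⟩
      · exact filter_subset_filter _ (filter_subset _ _)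
      rw [Matrix.of_apply, H _ (hne _)]
      refine sum_congr rfl fun l _ => ?_
      rw [zpow_sub₀ (he l)]
      ring) 1
  have hM1 : (Matrix.of fun i j : Fin n => ((Matrix.of fun i j : Fin n =>
      Polynomial.C (1 / kappa (-1) (s ^ (label j - label i))) *
      (Polynomial.X ^ ((c - (i.1 + 1)) + ((j.1 + 1) - c)) +
        Polynomial.X ^ (((i.1 + 1) - c) + (c - (j.1 + 1))))) i j).eval 1).det =
      2 ^ n * (Matrix.of fun i j : Fin n => 1 / kappa (-1) (s ^ label j / s ^ label i)).det := by
    have := Matrix.det_smul (Matrix.of fun i j : Fin n =>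
        1 / kappa (-1) (s ^ label j / s ^ label i)) 2
    rw [Fintype.card_fin] at this
    rw [← this]
    congr 1
    ext i j
    simp only [Matrix.of_apply, Polynomial.eval_mul, Polynomial.eval_C, Polynomial.eval_add,
      Polynomial.eval_pow, Polynomial.eval_X, Matrix.smul_apply, one_pow, smul_eq_mul]
    rw [zpow_sub₀ hs0]
    ring
  rw [hM1] at key
  have hc := det_cauchy_kappa (-1 : F) (fun i : Fin n => s ^ label i)
    (fun j => s ^ label j) (fun i => zpow_ne_zero _ hs0) (fun i => zpow_ne_zero _ hs0)
    (by simpa using zpow_label_sq_injective hs0 hs 0 n)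
    (fun i j => by rw [← zpow_sub₀ hs0]; exact hne _)
  have hT : (T₂ n s t) = Matrix.of fun i j : Fin n =>
      kappa (-1) (t ^ (label j - label i)) / kappa (-1) (s ^ (label j - label i)) := by
    ext i j; simp [T₂, τpq_eq_kappa]
  rw [← hT] at key
  have hS : ∏ i : Fin n, ∏ j ∈ Ioi i, kappa 1 (s ^ label i / s ^ label j) *
      kappa 1 (s ^ label j / s ^ label i) =
      (∏ i ∈ Icc (1 : ℤ) n, ∏ j ∈ Icc (1 : ℤ) n with i ≠ j ∧ 2 ∣ j - i, γpq s t 0 (j - i)) *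
        ∏ z ∈ S, (s ^ (z.2 - z.1) * 1 - s ^ (-(z.2 - z.1))) := by
    have h1 := prod_ne_eq_prod_label n fun i j => γpq s t 0 (j - i)
    rw [prod_congr rfl fun (i : Fin n) _ => prod_congr rfl fun (j : Fin n) (_ : j ∈ Ioi i) =>
      show kappa 1 (s ^ label i / s ^ label j) * kappa 1 (s ^ label j / s ^ label i) =
        γpq s t 0 (label j - label i) * γpq s t 0 (label i - label j) by
      rw [← zpow_sub₀ hs0, ← zpow_sub₀ hs0, mul_comm, γpq_eq_kappa,
        γpq_eq_kappa, zpow_zero, one_mul, one_mul], ← h1, hSdef, prod_filter, prod_product,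
      ← prod_mul_distrib]
    refine prod_congr rfl fun i _ => ?_
    rw [prod_filter, prod_filter, ← prod_mul_distrib]
    refine prod_congr rfl fun j _ => ?_
    have h3 : γpq s t 0 (j - i) = s ^ (j - i) * 1 - s ^ (-(j - i)) := by
      rw [γpq_eq_kappa, zpow_neg]; simp [kappa]
    by_cases hij : i = j
    · simp [hij]
    · by_cases hd : 2 ∣ j - i
      · simp [hij, hd]
      · simp [hij, hd, h3]
  have hD : ∏ i ∈ Icc (1 : ℤ) n, ∏ j ∈ Icc (1 : ℤ) n, τpq s t 0 (j - i) =
      ∏ i : Fin n, ∏ j : Fin n, kappa (-1) (s ^ label j / s ^ label i) := by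
    rw [prod_Icc_eq_prod_label]
    refine prod_congr rfl fun i _ => ?_
    rw [prod_Icc_eq_prod_label]
    refine prod_congr rfl fun j _ => ?_
    rw [← zpow_sub₀ hs0, τpq_eq_kappa, zpow_zero, one_mul]
  have hR : ∏ i ∈ Icc (1 : ℤ) n, ∏ j ∈ Icc (1 : ℤ) n with ¬ 2 ∣ j - i, γpq s t 1 (j - i) =
      ∏ z ∈ S, kappa 1 (t * s ^ (z.2 - z.1)) := by
    rw [hSdef, prod_filter, prod_product]
    simp only [prod_filter, γpq_eq_kappa, zpow_one]
  rw [hS] at hc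
  rw [hD, hR]
  have hS0 : ∏ z ∈ S, (s ^ (z.2 - z.1) * 1 - s ^ (-(z.2 - z.1))) ≠ 0 := by
    refine prod_ne_zero_iff.2 fun z hz => ?_
    have h3 : s ^ (z.2 - z.1) * 1 - s ^ (-(z.2 - z.1)) = kappa 1 (s ^ (z.2 - z.1)) := by
      rw [zpow_neg]; simp [kappa]
    rw [h3]
    rw [hSdef, mem_filter] at hz
    exact kappa_one_zpow_ne_zero hs0 hs fun h => hz.2 (h ▸ dvd_zero 2)
  apply mul_left_cancel₀ hS0
  linear_combination (∏ i : Fin n, ∏ j : Fin n,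
    kappa (-1) (s ^ label j / s ^ label i)) * key +
    (2 ^ n * ∏ z ∈ S, kappa 1 (t * s ^ (z.2 - z.1))) * hc

/-- The common form of the evaluations of `T₃` (`σ = 1`, `h = n`) and `T₄` (`σ = -1`, `h = 0`). -/
theorem det_sub_of_generic {F : Type*} [Field F] (n h : ℕ) {s t σ : F} (hσ : σ * σ = 1)
    (hs0 : s ≠ 0) (ht : t ≠ 0) (hs : ∀ k : ℤ, k ≠ 0 → s ^ k ≠ 1)
    (hneg : ∀ i j : Fin n, kappa σ (s ^ ((h : ℤ) + label j - label i)) ≠ 0)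
    (hpos : ∀ i j : Fin n, kappa σ (s ^ ((h : ℤ) + label j + label i)) ≠ 0)
    (S : Finset (ℤ × ℤ)) (hcard : n * (h + n + 1) = #S) (N : ℤ)
    (hN : ∀ z ∈ S, (N - z.1, N - z.2) ∈ S)
    (hS : S ⊆ Icc (1 : ℤ) (2 * n + 1) ×ˢ {j ∈ Icc (1 : ℤ) (2 * n + 1) | 2 ∣ j})
    (hSσ : ∀ z ∈ S, σ ^ (z.2 - z.1).natAbs = σ) :
    (Matrix.of fun i j : Fin n =>
      kappa σ (t ^ ((h : ℤ) + label j + label i)) / kappa σ (s ^ ((h : ℤ) + label j + label i)) -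
      kappa σ (t ^ ((h : ℤ) + label j - label i)) /
        kappa σ (s ^ ((h : ℤ) + label j - label i))).det * (-1) ^ #S *
      ∏ i : Fin n, ∏ j : Fin n, kappa σ (s ^ ((h : ℤ) + label j + label i)) =
    (-σ) ^ n * (σ ^ n.choose 2 * ∏ i : Fin n, ∏ j ∈ Ioi i,
      kappa 1 (s ^ (label j - label i)) ^ 2) * ∏ z ∈ S, kappa 1 (t * s ^ (z.2 - z.1)) := by
  have key := det_mul_prod_eq_of_rank hs0 ht hs S
    (fun z => z.2 - z.1)
    (fun w => Matrix.of fun i j : Fin n =>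
      kappa σ (w ^ ((h : ℤ) + label j + label i)) / kappa σ (s ^ ((h : ℤ) + label j + label i)) -
      kappa σ (w ^ ((h : ℤ) + label j - label i)) / kappa σ (s ^ ((h : ℤ) + label j - label i)))
    (Matrix.of fun i j =>
      Polynomial.C (1 / kappa σ (s ^ ((h : ℤ) + label j + label i))) *
        (Polynomial.X ^ ((i.1 + 1) + (h + j.1 + 1)) - Polynomial.C σ) -
      Polynomial.C (1 / kappa σ (s ^ ((h : ℤ) + label j - label i))) *
        (Polynomial.X ^ (h + j.1 + 1) - Polynomial.C σ * Polynomial.X ^ (i.1 + 1)))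
    (fun i => i.1 + 1) (fun j => h + j.1 + 1)
    (by
      rw [← hcard, Fin.sum_univ_eq_sum_range (fun i => i + 1),
        Fin.sum_univ_eq_sum_range (fun j => h + j + 1)]
      rw [sum_add_distrib, sum_add_distrib, sum_add_distrib]
      simp only [sum_const, card_range, smul_eq_mul, mul_one]
      have := sum_range_id_mul_two n
      rcases n with _ | n
      · simp
      · rw [Nat.add_sub_cancel] at this
        linarith)
    (fun i j => by
      rw [Matrix.of_apply]
      refine (Polynomial.natDegree_sub_le _ _).trans (max_le ?_ ?_)
      · refine (Polynomial.natDegree_C_mul_le _ _).trans ?_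
        refine (Polynomial.natDegree_sub_le _ _).trans ?_
        rw [Polynomial.natDegree_X_pow, Polynomial.natDegree_C]
        exact max_le le_rfl (Nat.zero_le _)
      · refine (Polynomial.natDegree_C_mul_le _ _).trans ?_
        refine (Polynomial.natDegree_sub_le _ _).trans (max_le ?_ ?_)
        · rw [Polynomial.natDegree_X_pow]; omega
        · refine (Polynomial.natDegree_C_mul_le _ _).trans ?_
          rw [Polynomial.natDegree_X_pow]; omega)
    (fun w hw i j => by
      simp only [Matrix.of_apply, Polynomial.eval_mul, Polynomial.eval_C, Polynomial.eval_sub,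
        Polynomial.eval_pow, Polynomial.eval_X]
      have e1 : (h : ℤ) + label j = ((h + j.1 + 1 : ℕ) : ℤ) := by simp only [label]; omega
      have e2 : label i = ((i.1 + 1 : ℕ) : ℤ) := by simp only [label]; omega
      have h1 := pow_ne_zero (i.1 + 1) hw
      have h2 := pow_ne_zero (h + j.1 + 1) hw
      have h3 : kappa σ (w ^ ((h : ℤ) + label j + label i)) *
          (w ^ (i.1 + 1) * w ^ (h + j.1 + 1)) =
          (w ^ 2) ^ ((i.1 + 1) + (h + j.1 + 1)) - σ := by
        rw [e1, e2, zpow_add₀ hw, zpow_natCast, zpow_natCast, pow_right_comm,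
          pow_add w (i.1 + 1) (h + j.1 + 1)]
        simp only [kappa]
        field_simp
      have h4 : kappa σ (w ^ ((h : ℤ) + label j - label i)) *
          (w ^ (i.1 + 1) * w ^ (h + j.1 + 1)) =
          (w ^ 2) ^ (h + j.1 + 1) - σ * (w ^ 2) ^ (i.1 + 1) := by
        rw [e1, e2, zpow_sub₀ hw, zpow_natCast, zpow_natCast, pow_right_comm,
          pow_right_comm w 2 (i.1 + 1)]
        simp only [kappa]
        field_simp
      rw [← h3, ← h4]
      ring)
    (fun k hk => by
      obtain ⟨z, hz⟩ := card_ne_zero.1 hk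
      rw [mem_filter] at hz
      have hk' : σ ^ k.natAbs = σ := by
        rw [show k.natAbs = (z.2 - z.1).natAbs by omega]
        exact hSσ z hz.1
      obtain ⟨c, e, H⟩ := exists_kappa_quot_sub_eq_sum hσ hs0 k hk'
      refine ⟨k.natAbs / 2, fun l i => c l * (e l ^ label i - (e l ^ label i)⁻¹),
        fun l j => e l ^ ((h : ℤ) + label j) - (e l ^ ((h : ℤ) + label j))⁻¹,
        (card_le_card (filter_subset_filter _ hS)).trans (card_even_sub_eq_le n k), fun i j => ?_⟩
      rw [Matrix.of_apply, H _ _ (hpos i j) (hneg i j)]) 0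
  rw [prod_zpow_mul_zero_sub hs0 _ N hN] at key
  have hM0 : (Matrix.of fun i j : Fin n => ((Matrix.of fun i j : Fin n =>
      Polynomial.C (1 / kappa σ (s ^ ((h : ℤ) + label j + label i))) *
        (Polynomial.X ^ ((i.1 + 1) + (h + j.1 + 1)) - Polynomial.C σ) -
      Polynomial.C (1 / kappa σ (s ^ ((h : ℤ) + label j - label i))) *
        (Polynomial.X ^ (h + j.1 + 1) - Polynomial.C σ * Polynomial.X ^ (i.1 + 1))) i j).eval
          0).det =
      (-σ) ^ n * (Matrix.of fun i j : Fin n =>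
        1 / kappa σ (s ^ ((h : ℤ) + label j) / s ^ (-label i))).det := by
    have := Matrix.det_smul (Matrix.of fun i j : Fin n =>
        1 / kappa σ (s ^ ((h : ℤ) + label j) / s ^ (-label i))) (-σ)
    rw [Fintype.card_fin] at this
    rw [← this]
    congr 1
    ext i j
    simp only [Matrix.of_apply, Polynomial.eval_mul, Polynomial.eval_C, Polynomial.eval_sub,
      Polynomial.eval_pow, Polynomial.eval_X, Matrix.smul_apply, smul_eq_mul]
    rw [← zpow_sub₀ hs0, sub_neg_eq_add, zero_pow (by omega), zero_pow (by omega),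
      zero_pow (by omega)]
    ring
  rw [hM0] at key
  have hc := det_cauchy_kappa σ (fun i : Fin n => s ^ (-label i))
    (fun j => s ^ ((h : ℤ) + label j)) (fun i => zpow_ne_zero _ hs0) (fun i => zpow_ne_zero _ hs0)
    (zpow_label_sq_injective hs0 hs _ _)
    (fun i j => by rw [← zpow_sub₀ hs0, sub_neg_eq_add]; exact hpos i j)
  have hV : ∏ i : Fin n, ∏ j ∈ Ioi i, kappa 1 (s ^ (-label i) / s ^ (-label j)) *
      kappa 1 (s ^ ((h : ℤ) + label j) / s ^ ((h : ℤ) + label i)) =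
      ∏ i : Fin n, ∏ j ∈ Ioi i, kappa 1 (s ^ (label j - label i)) ^ 2 := by
    refine prod_congr rfl fun i _ => prod_congr rfl fun j _ => ?_
    rw [← zpow_sub₀ hs0, ← zpow_sub₀ hs0, add_sub_add_left_eq_sub, neg_sub_neg, pow_two]
  have hD : ∏ i : Fin n, ∏ j : Fin n, kappa σ (s ^ ((h : ℤ) + label j + label i)) =
      ∏ i : Fin n, ∏ j : Fin n, kappa σ (s ^ ((h : ℤ) + label j) / s ^ (-label i)) := by
    refine prod_congr rfl fun i _ => prod_congr rfl fun j _ => ?_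
    rw [← zpow_sub₀ hs0, sub_neg_eq_add]
  rw [hV] at hc
  rw [hD, ← hc]
  linear_combination (∏ i : Fin n, ∏ j : Fin n,
    kappa σ (s ^ ((h : ℤ) + label j) / s ^ (-label i))) * key

/-- Pairs `i < j ≤ 2n` lie in the lower half, in the upper half, or one in each. -/
theorem prod_lt_two_mul {M : Type*} [CommMonoid M] (n : ℕ) (f : ℤ → M) :
    ∏ i ∈ Icc (1 : ℤ) (2 * n), ∏ j ∈ Icc (1 : ℤ) (2 * n) with i < j, f (j - i) =
      (∏ i ∈ Icc (1 : ℤ) n, ∏ j ∈ Icc (1 : ℤ) n with i < j, f (j - i)) ^ 2 *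
        ∏ i ∈ Icc (1 : ℤ) n, ∏ j ∈ Icc (1 : ℤ) n, f (n + j - i) := by
  have split : ∀ g : ℤ → M, ∏ i ∈ Icc (1 : ℤ) (2 * n), g i =
      (∏ i ∈ Icc (1 : ℤ) n, g i) * ∏ i ∈ Icc (1 : ℤ) n, g (n + i) := fun g => by
    have h1 : Icc (1 : ℤ) (2 * n) = Icc (1 : ℤ) n ∪ (Icc (1 : ℤ) n).image ((n : ℤ) + ·) := by
      ext z
      simp only [mem_union, mem_image, mem_Icc]
      refine ⟨fun h => ?_, ?_⟩
      · rcases le_or_gt z n with h' | h'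
        · left; omega
        · exact Or.inr ⟨z - n, by omega, by omega⟩
      · rintro (h | ⟨a, h, rfl⟩) <;> omega
    rw [h1, prod_union, prod_image fun a _ b _ hab => by simpa using hab]
    rw [disjoint_left]
    intro z hz hz'
    simp only [mem_image, mem_Icc] at hz hz'
    omega
  simp only [prod_filter]
  rw [split]
  simp only [split]
  rw [prod_mul_distrib, prod_mul_distrib]
  have h1 : ∏ i ∈ Icc (1 : ℤ) n, ∏ j ∈ Icc (1 : ℤ) n,
      (if i < n + j then f (n + j - i) else 1) =
      ∏ i ∈ Icc (1 : ℤ) n, ∏ j ∈ Icc (1 : ℤ) n, f (n + j - i) :=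
    prod_congr rfl fun i hi => prod_congr rfl fun j hj => by
      rw [mem_Icc] at hi hj; rw [if_pos (by omega)]
  have h2 : ∏ i ∈ Icc (1 : ℤ) n, ∏ j ∈ Icc (1 : ℤ) n,
      (if n + i < j then f (j - (n + i)) else 1) = 1 :=
    prod_eq_one fun i hi => prod_eq_one fun j hj => by
      rw [mem_Icc] at hi hj; rw [if_neg (by omega)]
  rw [h1, h2, one_mul, pow_two]
  simp only [add_lt_add_iff_left, add_sub_add_left_eq_sub]
  exact mul_right_comm _ _ _

theorem det_T₃_of_generic {F : Type*} [Field F] (n : ℕ) {s t : F} (hs0 : s ≠ 0) (ht : t ≠ 0)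
    (hs : ∀ k : ℤ, k ≠ 0 → s ^ k ≠ 1) :
    (T₃ n s t).det * ∏ i ∈ Icc (1 : ℤ) n, ∏ j ∈ Icc (1 : ℤ) n,
          (γpq s t 0 (n + j - i) * γpq s t 0 (n + j + i)) =
      (∏ i ∈ Icc (1 : ℤ) (2 * n), ∏ j ∈ Icc (1 : ℤ) (2 * n) with i < j, γpq s t 0 (j - i)) *
        ∏ i ∈ Icc (1 : ℤ) (2 * n + 1), ∏ j ∈ Icc (1 : ℤ) (2 * n + 1) with 2 ∣ j,
          γpq s t 1 (j - i) := by
  have key := det_sub_of_generic n n (one_mul (1 : F)) hs0 ht hs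
    (fun i j => kappa_one_zpow_ne_zero hs0 hs (by simp only [label]; omega))
    (fun i j => kappa_one_zpow_ne_zero hs0 hs (by simp only [label]; omega))
    (Icc (1 : ℤ) (2 * n + 1) ×ˢ {j ∈ Icc (1 : ℤ) (2 * n + 1) | 2 ∣ j})
    (by
      rw [card_product, card_filter_even_Icc, Int.card_Icc, mul_comm]
      congr 1; omega)
    (2 * n + 2)
    (fun z hz => by simp only [mem_product, mem_filter, mem_Icc] at hz ⊢; omega)
    (subset_refl _) (fun z _ => one_pow _)
  have hT : (T₃ n s t) = Matrix.of fun i j : Fin n =>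
      kappa 1 (t ^ ((n : ℤ) + label j + label i)) / kappa 1 (s ^ ((n : ℤ) + label j + label i)) -
      kappa 1 (t ^ ((n : ℤ) + label j - label i)) /
        kappa 1 (s ^ ((n : ℤ) + label j - label i)) := by
    ext i j; simp [T₃, γpq_eq_kappa]
  have hsign : (-1 : F) ^ #(Icc (1 : ℤ) (2 * n + 1) ×ˢ {j ∈ Icc (1 : ℤ) (2 * n + 1) | 2 ∣ j}) =
      (-1) ^ n := by
    have : #(Icc (1 : ℤ) (2 * n + 1)) = 2 * n + 1 := by rw [Int.card_Icc]; omega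
    rw [card_product, card_filter_even_Icc, this, pow_mul, pow_succ, pow_mul]
    simp
  rw [← hT, hsign, one_pow, one_mul, prod_product] at key
  rw [prod_lt_two_mul, prod_lt_eq_prod_label n fun i j => γpq s t 0 (j - i)]
  simp only [prod_mul_distrib]
  simp only [prod_pow] at key
  have hD : ∏ i ∈ Icc (1 : ℤ) n, ∏ j ∈ Icc (1 : ℤ) n, γpq s t 0 (n + j + i) =
      ∏ i : Fin n, ∏ j : Fin n, kappa 1 (s ^ ((n : ℤ) + label j + label i)) := by
    rw [prod_Icc_eq_prod_label]
    refine prod_congr rfl fun i _ => ?_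
    rw [prod_Icc_eq_prod_label]
    refine prod_congr rfl fun j _ => ?_
    rw [γpq_eq_kappa, zpow_zero, one_mul]
  have hV : ∏ i : Fin n, ∏ j ∈ Ioi i, γpq s t 0 (label j - label i) =
      ∏ i : Fin n, ∏ j ∈ Ioi i, kappa 1 (s ^ (label j - label i)) := by
    simp only [γpq_eq_kappa, zpow_zero, one_mul]
  have hR : ∏ i ∈ Icc (1 : ℤ) (2 * n + 1), ∏ j ∈ Icc (1 : ℤ) (2 * n + 1) with 2 ∣ j,
      γpq s t 1 (j - i) = ∏ i ∈ Icc (1 : ℤ) (2 * n + 1),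
        ∏ j ∈ Icc (1 : ℤ) (2 * n + 1) with 2 ∣ j, kappa 1 (t * s ^ (j - i)) := by
    simp only [γpq_eq_kappa, zpow_one]
  rw [hD, hV, hR]
  apply mul_left_cancel₀ (pow_ne_zero n (neg_ne_zero.2 (one_ne_zero (α := F))))
  linear_combination (∏ i ∈ Icc (1 : ℤ) n, ∏ j ∈ Icc (1 : ℤ) n, γpq s t 0 (n + j - i)) * key

theorem det_T₄_of_generic {F : Type*} [Field F] (n : ℕ) {s t : F} (hs0 : s ≠ 0) (ht : t ≠ 0)
    (hs : ∀ k : ℤ, k ≠ 0 → s ^ k ≠ 1) (h2 : (2 : F) ≠ 0) :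
    (T₄ n s t).det * ∏ i ∈ Icc (1 : ℤ) n, ∏ j ∈ Icc (1 : ℤ) n,
          (τpq s t 0 (j - i) * τpq s t 0 (j + i)) =
      (-1) ^ n.choose 2 *
        (2 ^ n *
          (∏ i ∈ Icc (1 : ℤ) n, ∏ j ∈ Icc (1 : ℤ) n with i < j,
            γpq s t 0 (2 * (j - i)) ^ 2) *
          ∏ i ∈ Icc (1 : ℤ) (2 * n + 1) with ¬ 2 ∣ i,
            ∏ j ∈ Icc (1 : ℤ) (2 * n + 1) with 2 ∣ j, γpq s t 1 (j - i)) := by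
  have hne := kappa_neg_one_zpow_ne_zero hs0 hs h2
  have key := det_sub_of_generic n 0 (σ := (-1 : F)) (by norm_num) hs0 ht hs
    (fun i j => hne _) (fun i j => hne _)
    ({i ∈ Icc (1 : ℤ) (2 * n + 1) | ¬ 2 ∣ i} ×ˢ {j ∈ Icc (1 : ℤ) (2 * n + 1) | 2 ∣ j})
    (by rw [card_product, card_filter_even_Icc, card_filter_odd_Icc, mul_comm, zero_add])
    (2 * n + 2)
    (fun z hz => by simp only [mem_product, mem_filter, mem_Icc] at hz ⊢; omega)
    (product_subset_product_left (filter_subset _ _))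
    (fun z hz => by
      simp only [mem_product, mem_filter] at hz
      refine Odd.neg_one_pow ?_
      rw [Int.natAbs_odd, ← Int.not_even_iff_odd, even_iff_two_dvd]; omega)
  have hT : (T₄ n s t) = Matrix.of fun i j : Fin n =>
      kappa (-1) (t ^ (((0 : ℕ) : ℤ) + label j + label i)) /
        kappa (-1) (s ^ (((0 : ℕ) : ℤ) + label j + label i)) -
      kappa (-1) (t ^ (((0 : ℕ) : ℤ) + label j - label i)) /
        kappa (-1) (s ^ (((0 : ℕ) : ℤ) + label j - label i)) := by
    ext i j; simp [T₄, τpq_eq_kappa]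
  have hsign : (-1 : F) ^ #({i ∈ Icc (1 : ℤ) (2 * n + 1) | ¬ 2 ∣ i} ×ˢ
      {j ∈ Icc (1 : ℤ) (2 * n + 1) | 2 ∣ j}) = 1 := by
    rw [card_product, card_filter_even_Icc, card_filter_odd_Icc, mul_comm]
    exact (Nat.even_mul_succ_self n).neg_one_pow
  rw [← hT, hsign, mul_one, neg_neg, one_pow, one_mul, prod_product] at key
  rw [prod_lt_eq_prod_label n fun i j => γpq s t 0 (2 * (j - i)) ^ 2]
  simp only [prod_mul_distrib]
  have hD : ∏ i ∈ Icc (1 : ℤ) n, ∏ j ∈ Icc (1 : ℤ) n, τpq s t 0 (j + i) =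
      ∏ i : Fin n, ∏ j : Fin n, kappa (-1) (s ^ (((0 : ℕ) : ℤ) + label j + label i)) := by
    rw [prod_Icc_eq_prod_label]
    refine prod_congr rfl fun i _ => ?_
    rw [prod_Icc_eq_prod_label]
    refine prod_congr rfl fun j _ => ?_
    rw [τpq_eq_kappa, zpow_zero, one_mul, Nat.cast_zero, zero_add]
  -- The diagonal contributes `τ(1) = 2`, and `γ(y^2) = γ(y) τ(y)` off the diagonal.
  have hV : 2 ^ n * ∏ i : Fin n, ∏ j ∈ Ioi i, γpq s t 0 (2 * (label j - label i)) ^ 2 =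
      (∏ i : Fin n, ∏ j ∈ Ioi i, kappa 1 (s ^ (label j - label i)) ^ 2) *
        ∏ i ∈ Icc (1 : ℤ) n, ∏ j ∈ Icc (1 : ℤ) n, τpq s t 0 (j - i) := by
    have h1 : ∏ i ∈ Icc (1 : ℤ) n, ∏ j ∈ Icc (1 : ℤ) n, τpq s t 0 (j - i) =
        2 ^ n * ∏ i : Fin n, ∏ j ∈ Ioi i,
          kappa (-1) (s ^ (label j - label i)) * kappa (-1) (s ^ (label i - label j)) := by
      rw [← prod_prod_ne_eq (fun i j : Fin n => kappa (-1) (s ^ (label j - label i))),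
        prod_Icc_eq_prod_label]
      have : (2 : F) ^ n = ∏ _i : Fin n, 2 := by simp
      rw [this, ← prod_mul_distrib]
      refine prod_congr rfl fun i _ => ?_
      rw [prod_Icc_eq_prod_label, ← mul_prod_erase univ _ (mem_univ i)]
      simp only [τpq_eq_kappa, zpow_zero, one_mul, sub_self]
      congr 1
      simp [kappa, one_add_one_eq_two]
    rw [h1, mul_left_comm, ← prod_mul_distrib]
    congr 1
    refine prod_congr rfl fun i _ => ?_
    rw [← prod_mul_distrib]
    refine prod_congr rfl fun j _ => ?_
    rw [γpq_eq_kappa, ← neg_sub (label j) (label i), zpow_neg, mul_comm 2, zpow_mul]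
    have := zpow_ne_zero (label j - label i) hs0
    simp only [kappa, zpow_zero, one_mul, inv_inv]
    rw [show (2 : ℤ) = ((2 : ℕ) : ℤ) from rfl, zpow_natCast]
    field_simp
    ring
  have hR : ∏ i ∈ Icc (1 : ℤ) (2 * n + 1) with ¬ 2 ∣ i,
      ∏ j ∈ Icc (1 : ℤ) (2 * n + 1) with 2 ∣ j, γpq s t 1 (j - i) =
      ∏ i ∈ Icc (1 : ℤ) (2 * n + 1) with ¬ 2 ∣ i,
        ∏ j ∈ Icc (1 : ℤ) (2 * n + 1) with 2 ∣ j, kappa 1 (t * s ^ (j - i)) := by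
    simp only [γpq_eq_kappa, zpow_one]
  rw [hD, hV, hR]
  linear_combination (∏ i ∈ Icc (1 : ℤ) n, ∏ j ∈ Icc (1 : ℤ) n, τpq s t 0 (j - i)) * key

/-! ### Specialisation to an arbitrary `p` -/

/-- The Laurent polynomial `t^a T^b - σ t^{-a} T^{-b}` in the indeterminate `T = p^{1/2}`, the
universal form of `γ(q^a p^b)` (for `σ = 1`) and `τ(q^a p^b)` (for `σ = -1`). -/
noncomputable def laurentKappa {K : Type*} [Field K] (σ t : K) (a b : ℤ) : LaurentPolynomial K :=
  LaurentPolynomial.C (t ^ a) * LaurentPolynomial.T b -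
    LaurentPolynomial.C σ * (LaurentPolynomial.C (t ^ (-a)) * LaurentPolynomial.T (-b))

theorem map_T_eq_zpow {K E : Type*} [Field K] [Field E] (ψ : LaurentPolynomial K →+* E) (m : ℤ) :
    ψ (LaurentPolynomial.T m) = ψ (LaurentPolynomial.T 1) ^ m := by
  have hnat : ∀ k : ℕ, ψ (LaurentPolynomial.T k) = ψ (LaurentPolynomial.T 1) ^ k := fun k => by
    rw [← map_pow, LaurentPolynomial.T_pow, mul_one]
  obtain ⟨k, rfl | rfl⟩ := m.eq_nat_or_neg
  · rw [zpow_natCast, hnat]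
  · rw [zpow_neg, zpow_natCast, ← hnat]
    refine eq_inv_of_mul_eq_one_left ?_
    rw [← map_mul, ← LaurentPolynomial.T_add, neg_add_cancel, LaurentPolynomial.T_zero, map_one]

theorem map_laurentKappa {K E : Type*} [Field K] [Field E] (ψ : LaurentPolynomial K →+* E)
    (σ t : K) (a b : ℤ) :
    ψ (laurentKappa σ t a b) = kappa (ψ (LaurentPolynomial.C σ))
      (ψ (LaurentPolynomial.C t) ^ a * ψ (LaurentPolynomial.T 1) ^ b) := by
  have hC : ∀ m : ℤ, ψ (LaurentPolynomial.C (t ^ m)) = ψ (LaurentPolynomial.C t) ^ m := fun m =>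
    map_zpow₀ (ψ.comp LaurentPolynomial.C) t m
  simp only [laurentKappa, kappa, map_sub, map_mul]
  rw [hC, hC, map_T_eq_zpow ψ b, map_T_eq_zpow ψ (-b), zpow_neg, zpow_neg, mul_inv]

theorem map_laurentKappa_one {K E : Type*} [Field K] [Field E] (ψ : LaurentPolynomial K →+* E)
    (t : K) (a b : ℤ) : ψ (laurentKappa 1 t a b) =
      γpq (ψ (LaurentPolynomial.T 1)) (ψ (LaurentPolynomial.C t)) a b := by
  rw [map_laurentKappa, γpq_eq_kappa, map_one, map_one]

theorem map_laurentKappa_neg_one {K E : Type*} [Field K] [Field E]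
    (ψ : LaurentPolynomial K →+* E) (t : K) (a b : ℤ) : ψ (laurentKappa (-1) t a b) =
      τpq (ψ (LaurentPolynomial.T 1)) (ψ (LaurentPolynomial.C t)) a b := by
  rw [map_laurentKappa, τpq_eq_kappa, map_neg, map_neg, map_one, map_one]

/-- An evaluation of a determinant of quotients that holds for generic `p` holds for every `p` for
which no denominator vanishes. The hypothesis `h` is the evaluation over the field of rational
functions in `p^{1/2}`. -/
theorem det_div_specialize_laurent {K : Type*} [Field K] {n : ℕ}
    (N D : ℤ → ℤ → LaurentPolynomial K) (P : LaurentPolynomial K) (φ : LaurentPolynomial K →+* K)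
    (hD : ∀ i ∈ Icc (1 : ℤ) n, ∀ j ∈ Icc (1 : ℤ) n, φ (D i j) ≠ 0)
    (h : ∀ ι : LaurentPolynomial K →+* FractionRing (LaurentPolynomial K),
      Function.Injective ι → (∀ k : ℤ, k ≠ 0 → ι (LaurentPolynomial.T 1) ^ k ≠ 1) →
      (Matrix.of fun i j : Fin n => ι (N (label i) (label j)) / ι (D (label i) (label j))).det *
        ∏ i ∈ Icc (1 : ℤ) n, ∏ j ∈ Icc (1 : ℤ) n, ι (D i j) = ι P) :
    (Matrix.of fun i j : Fin n => φ (N (label i) (label j)) / φ (D (label i) (label j))).det =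
      φ P / ∏ i ∈ Icc (1 : ℤ) n, ∏ j ∈ Icc (1 : ℤ) n, φ (D i j) := by
  have hι := IsFractionRing.injective (LaurentPolynomial K) (FractionRing (LaurentPolynomial K))
  have hl : ∀ i : Fin n, label i ∈ Icc (1 : ℤ) n := fun i => by
    rw [mem_Icc]; simp only [label]; omega
  rw [eq_div_iff (prod_ne_zero_iff.2 fun i hi => prod_ne_zero_iff.2 fun j hj => hD i hi j hj)]
  have h1 := h _ hι fun k hk h1 => by
    rw [← map_T_eq_zpow] at h1
    have h2 : (LaurentPolynomial.T k : LaurentPolynomial K) = LaurentPolynomial.T 0 :=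
      hι (by rw [h1, LaurentPolynomial.T_zero, map_one])
    have h3 : (k : WithBot ℤ) = ((0 : ℤ) : WithBot ℤ) := by
      rw [← LaurentPolynomial.degree_T (R := K) k, h2, LaurentPolynomial.degree_T]
    exact hk (by exact_mod_cast h3)
  simp only [prod_Icc_eq_prod_label] at h1 ⊢
  exact det_div_specialize _ hι φ (fun i j : Fin n => N (label i) (label j))
    (fun i j => D (label i) (label j)) P (fun i j => hD _ (hl i) _ (hl j)) h1

theorem T₃_eq_of_ne_zero {K : Type*} [Field K] {n : ℕ} {s t : K}
    (h : ∀ i ∈ Icc (1 : ℤ) n, ∀ j ∈ Icc (1 : ℤ) n,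
      γpq s t 0 (n + j - i) ≠ 0 ∧ γpq s t 0 (n + j + i) ≠ 0) :
    T₃ n s t = Matrix.of fun i j : Fin n =>
      (γpq s t (n + label j + label i) 0 * γpq s t 0 (n + label j - label i) -
        γpq s t 0 (n + label j + label i) * γpq s t (n + label j - label i) 0) /
      (γpq s t 0 (n + label j - label i) * γpq s t 0 (n + label j + label i)) := by
  ext i j
  have hl : ∀ i : Fin n, label i ∈ Icc (1 : ℤ) n := fun i => by
    rw [mem_Icc]; simp only [label]; omega
  obtain ⟨h1, h2⟩ := h _ (hl i) _ (hl j)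
  simp only [T₃, Matrix.of_apply]
  rw [div_sub_div _ _ h2 h1, mul_comm (γpq s t 0 (n + label j - label i))
    (γpq s t 0 (n + label j + label i))]

theorem T₄_eq_of_ne_zero {K : Type*} [Field K] {n : ℕ} {s t : K}
    (h : ∀ i ∈ Icc (1 : ℤ) n, ∀ j ∈ Icc (1 : ℤ) n,
      τpq s t 0 (j - i) ≠ 0 ∧ τpq s t 0 (j + i) ≠ 0) :
    T₄ n s t = Matrix.of fun i j : Fin n =>
      (τpq s t (label j + label i) 0 * τpq s t 0 (label j - label i) -
        τpq s t 0 (label j + label i) * τpq s t (label j - label i) 0) /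
      (τpq s t 0 (label j - label i) * τpq s t 0 (label j + label i)) := by
  ext i j
  have hl : ∀ i : Fin n, label i ∈ Icc (1 : ℤ) n := fun i => by
    rw [mem_Icc]; simp only [label]; omega
  obtain ⟨h1, h2⟩ := h _ (hl i) _ (hl j)
  simp only [T₄, Matrix.of_apply]
  rw [div_sub_div _ _ h2 h1, mul_comm (τpq s t 0 (label j - label i))
    (τpq s t 0 (label j + label i))]

/-- Here `s = p^{1/2}` and `t = q^{1/2}`; `γpq s t a b = γ(q^a p^b)` and
`τpq s t a b = τ(q^a p^b)`. Each evaluation holds as soon as the denominators of the entries of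
the matrix do not vanish. -/
theorem mainTheorem6 {K : Type*} [Field K] (n : ℕ) (s t : K) (hs : s ≠ 0) (ht : t ≠ 0) :
    ((∀ i ∈ Icc (1 : ℤ) n, ∀ j ∈ Icc (1 : ℤ) n, γpq s t 0 (n + j - i) ≠ 0) →
      (T₁ n s t).det =
        ((∏ i ∈ Icc (1 : ℤ) n, ∏ j ∈ Icc (1 : ℤ) n with i ≠ j, γpq s t 0 (j - i)) *
          ∏ i ∈ Icc (1 : ℤ) n, ∏ j ∈ Icc (1 : ℤ) n, γpq s t 1 (j - i)) /
        ∏ i ∈ Icc (1 : ℤ) n, ∏ j ∈ Icc (1 : ℤ) n, γpq s t 0 (n + j - i)) ∧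
    ((∀ i ∈ Icc (1 : ℤ) n, ∀ j ∈ Icc (1 : ℤ) n, τpq s t 0 (j - i) ≠ 0) →
      (T₂ n s t).det =
        (-1) ^ n.choose 2 *
        ((2 ^ n *
          (∏ i ∈ Icc (1 : ℤ) n, ∏ j ∈ Icc (1 : ℤ) n with i ≠ j ∧ 2 ∣ j - i,
            γpq s t 0 (j - i)) *
          ∏ i ∈ Icc (1 : ℤ) n, ∏ j ∈ Icc (1 : ℤ) n with ¬ 2 ∣ j - i, γpq s t 1 (j - i)) /
        ∏ i ∈ Icc (1 : ℤ) n, ∏ j ∈ Icc (1 : ℤ) n, τpq s t 0 (j - i))) ∧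
    ((∀ i ∈ Icc (1 : ℤ) n, ∀ j ∈ Icc (1 : ℤ) n,
        γpq s t 0 (n + j - i) ≠ 0 ∧ γpq s t 0 (n + j + i) ≠ 0) →
      (T₃ n s t).det =
        ((∏ i ∈ Icc (1 : ℤ) (2 * n), ∏ j ∈ Icc (1 : ℤ) (2 * n) with i < j,
            γpq s t 0 (j - i)) *
          ∏ i ∈ Icc (1 : ℤ) (2 * n + 1), ∏ j ∈ Icc (1 : ℤ) (2 * n + 1) with 2 ∣ j,
            γpq s t 1 (j - i)) /
        ∏ i ∈ Icc (1 : ℤ) n, ∏ j ∈ Icc (1 : ℤ) n,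
          (γpq s t 0 (n + j - i) * γpq s t 0 (n + j + i))) ∧
    ((∀ i ∈ Icc (1 : ℤ) n, ∀ j ∈ Icc (1 : ℤ) n,
        τpq s t 0 (j - i) ≠ 0 ∧ τpq s t 0 (j + i) ≠ 0) →
      (T₄ n s t).det =
        (-1) ^ n.choose 2 *
        ((2 ^ n *
          (∏ i ∈ Icc (1 : ℤ) n, ∏ j ∈ Icc (1 : ℤ) n with i < j,
            γpq s t 0 (2 * (j - i)) ^ 2) *
          ∏ i ∈ Icc (1 : ℤ) (2 * n + 1) with ¬ 2 ∣ i,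
            ∏ j ∈ Icc (1 : ℤ) (2 * n + 1) with 2 ∣ j, γpq s t 1 (j - i)) /
        ∏ i ∈ Icc (1 : ℤ) n, ∏ j ∈ Icc (1 : ℤ) n,
          (τpq s t 0 (j - i) * τpq s t 0 (j + i)))) := by

  -- Evaluation of Laurent polynomials at `T = s`.
  set φ : LaurentPolynomial K →+* K :=
    LaurentPolynomial.eval₂ (RingHom.id K) (Units.mk0 s hs) with hφ
  have hφT : φ (LaurentPolynomial.T 1) = s := by simp [hφ, LaurentPolynomial.eval₂_T]
  have hφC : φ (LaurentPolynomial.C t) = t := by simp [hφ]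
  have hγ : ∀ a b, φ (laurentKappa 1 t a b) = γpq s t a b := fun a b => by
    rw [map_laurentKappa_one, hφT, hφC]
  have hτ : ∀ a b, φ (laurentKappa (-1) t a b) = τpq s t a b := fun a b => by
    rw [map_laurentKappa_neg_one, hφT, hφC]
  have hunit : ∀ ι : LaurentPolynomial K →+* FractionRing (LaurentPolynomial K),
      ι (LaurentPolynomial.T 1) ≠ 0 ∧ ι (LaurentPolynomial.C t) ≠ 0 := fun ι =>
    ⟨((LaurentPolynomial.isUnit_T 1).map ι).ne_zero,
      (((isUnit_iff_ne_zero.2 ht).map LaurentPolynomial.C).map ι).ne_zero⟩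
  -- A nonempty `T₂` or `T₄` has a denominator `τ(1) = 2`.
  have htwo : τpq s t 0 (1 - 1) ≠ 0 →
      ∀ ι : LaurentPolynomial K →+* FractionRing (LaurentPolynomial K),
      Function.Injective ι → (2 : FractionRing (LaurentPolynomial K)) ≠ 0 := by
    intro h ι hι h2
    have h3 : (2 : LaurentPolynomial K) = 0 := hι (by rw [map_ofNat, h2, map_zero])
    have h4 : (2 : K) = 0 := by rw [← map_ofNat φ 2, h3, map_zero]
    apply h
    simpa [τpq, tauOfSqrt, one_add_one_eq_two] using h4
  refine ⟨fun h => ?_, fun h => ?_, fun h => ?_, fun h => ?_⟩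
  · have key := det_div_specialize_laurent (n := n)
      (fun i j => laurentKappa 1 t (n + j - i) 0) (fun i j => laurentKappa 1 t 0 (n + j - i))
      ((∏ i ∈ Icc (1 : ℤ) n, ∏ j ∈ Icc (1 : ℤ) n with i ≠ j, laurentKappa 1 t 0 (j - i)) *
          ∏ i ∈ Icc (1 : ℤ) n, ∏ j ∈ Icc (1 : ℤ) n, laurentKappa 1 t 1 (j - i)) φ
      (fun i hi j hj => by rw [hγ]; exact h i hi j hj)
      (fun ι _ hs' => by
        simp only [map_mul, map_prod, map_laurentKappa_one]
        exact det_T₁_of_generic n (hunit ι).1 (hunit ι).2 hs')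
    simp only [map_mul, map_prod, hγ] at key
    exact key
  · rcases eq_or_ne n 0 with rfl | hn
    · simp
    have h1 : (1 : ℤ) ∈ Icc (1 : ℤ) n := by rw [mem_Icc]; omega
    have key := det_div_specialize_laurent (n := n)
      (fun i j => laurentKappa (-1) t (j - i) 0) (fun i j => laurentKappa (-1) t 0 (j - i))
      ((-1) ^ n.choose 2 * (2 ^ n *
        (∏ i ∈ Icc (1 : ℤ) n, ∏ j ∈ Icc (1 : ℤ) n with i ≠ j ∧ 2 ∣ j - i,
          laurentKappa 1 t 0 (j - i)) *
        ∏ i ∈ Icc (1 : ℤ) n, ∏ j ∈ Icc (1 : ℤ) n with ¬ 2 ∣ j - i, laurentKappa 1 t 1 (j - i))) φ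
      (fun i hi j hj => by rw [hτ]; exact h i hi j hj)
      (fun ι hι hs' => by
        simp only [map_mul, map_pow, map_neg, map_one, map_ofNat, map_prod, map_laurentKappa_one,
          map_laurentKappa_neg_one]
        exact det_T₂_of_generic n (hunit ι).1 (hunit ι).2 hs' (htwo (h 1 h1 1 h1) ι hι))
    simp only [map_mul, map_pow, map_neg, map_one, map_ofNat, map_prod, hγ, hτ] at key
    rw [← mul_div_assoc]
    exact key
  · have key := det_div_specialize_laurent (n := n)
      (fun i j => laurentKappa 1 t (n + j + i) 0 * laurentKappa 1 t 0 (n + j - i) -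
        laurentKappa 1 t 0 (n + j + i) * laurentKappa 1 t (n + j - i) 0)
      (fun i j => laurentKappa 1 t 0 (n + j - i) * laurentKappa 1 t 0 (n + j + i))
      ((∏ i ∈ Icc (1 : ℤ) (2 * n), ∏ j ∈ Icc (1 : ℤ) (2 * n) with i < j,
          laurentKappa 1 t 0 (j - i)) *
        ∏ i ∈ Icc (1 : ℤ) (2 * n + 1), ∏ j ∈ Icc (1 : ℤ) (2 * n + 1) with 2 ∣ j,
          laurentKappa 1 t 1 (j - i)) φ
      (fun i hi j hj => by
        rw [map_mul, hγ, hγ]; exact mul_ne_zero (h i hi j hj).1 (h i hi j hj).2)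
      (fun ι hι hs' => by
        simp only [map_mul, map_sub, map_prod, map_laurentKappa_one]
        rw [← T₃_eq_of_ne_zero]
        · exact det_T₃_of_generic n (hunit ι).1 (hunit ι).2 hs'
        · intro i hi j hj
          simp only [← map_laurentKappa_one ι, ne_eq, map_eq_zero_iff ι hι]
          exact ⟨fun h0 => (h i hi j hj).1 (by rw [← hγ, h0, map_zero]),
            fun h0 => (h i hi j hj).2 (by rw [← hγ, h0, map_zero])⟩)
    simp only [map_mul, map_sub, map_prod, hγ] at key
    rw [T₃_eq_of_ne_zero h]
    exact key
  · rcases eq_or_ne n 0 with rfl | hn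
    · simp [filter_singleton, show ¬ (2 : ℤ) ∣ 1 by decide]
    have h1 : (1 : ℤ) ∈ Icc (1 : ℤ) n := by rw [mem_Icc]; omega
    have key := det_div_specialize_laurent (n := n)
      (fun i j => laurentKappa (-1) t (j + i) 0 * laurentKappa (-1) t 0 (j - i) -
        laurentKappa (-1) t 0 (j + i) * laurentKappa (-1) t (j - i) 0)
      (fun i j => laurentKappa (-1) t 0 (j - i) * laurentKappa (-1) t 0 (j + i))
      ((-1) ^ n.choose 2 * (2 ^ n *
        (∏ i ∈ Icc (1 : ℤ) n, ∏ j ∈ Icc (1 : ℤ) n with i < j,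
          laurentKappa 1 t 0 (2 * (j - i)) ^ 2) *
        ∏ i ∈ Icc (1 : ℤ) (2 * n + 1) with ¬ 2 ∣ i,
          ∏ j ∈ Icc (1 : ℤ) (2 * n + 1) with 2 ∣ j, laurentKappa 1 t 1 (j - i))) φ
      (fun i hi j hj => by
        rw [map_mul, hτ, hτ]; exact mul_ne_zero (h i hi j hj).1 (h i hi j hj).2)
      (fun ι hι hs' => by
        simp only [map_mul, map_sub, map_pow, map_neg, map_one, map_ofNat, map_prod,
          map_laurentKappa_one, map_laurentKappa_neg_one]
        rw [← T₄_eq_of_ne_zero]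
        · exact det_T₄_of_generic n (hunit ι).1 (hunit ι).2 hs'
            (htwo (h 1 h1 1 h1).1 ι hι)
        · intro i hi j hj
          simp only [← map_laurentKappa_neg_one ι, ne_eq, map_eq_zero_iff ι hι]
          exact ⟨fun h0 => (h i hi j hj).1 (by rw [← hτ, h0, map_zero]),
            fun h0 => (h i hi j hj).2 (by rw [← hτ, h0, map_zero])⟩)
    simp only [map_mul, map_sub, map_pow, map_neg, map_one, map_ofNat, map_prod, hγ, hτ] at key
    rw [T₄_eq_of_ne_zero h, ← mul_div_assoc]
    exact key
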